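/- Let $(M,\gamma,J)$ be a Hermitian manifold: $M$ is a smooth manifold, $\gamma$ a Riemannian metric, $J$ a smooth $\gamma$-orthogonal almost complex structure whose Nijenhuis tensor vanishes. Let $\Omega(X,Y)=\gamma(JX,Y)$ be its Kähler form. Let $\iota:N\to M$ be an immersed submanifold with normal bundle $\nu N$ (the $\gamma$-orthogonal complement of $TN$ in $TM|_N$) and second fundamental form $b$, i.e. $b(X,Y)\in\nu N$ is the normal component of $\nabla_XY$ for $X,Y$ tangent to $N$, where $\nabla$ is the Levi-Civita connection of $\gamma$. Assume that $N$ is a CR-submanifold, i.e. that $$TN=(TN\cap J(TN))\oplus(TN\cap J(\nu N))$$ at every point of $N$, both terms having constant rank. Let $F$ be the induced F structure of $N$, i.e. the field of endomorphisms of $TN$ with $F=J$ on $TN\cap J(TN)$ and $F=0$ on $TN\cap J(\nu N)$. A field $F$ of endomorphisms of $TN$ is called a classical CRF structure if it is smooth, $F^3+F=0$, and the $i$-eigenbundle of the endomorphism $(X,\alpha)\mapsto(FX,-\alpha\circ F)$ of the complexification of $TN\oplus T^*N$ is closed under the Courant bracket $$[(X,\alpha),(Y,\beta)]=\bigl([X,Y],\;L_X\beta-L_Y\alpha+\tfrac12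 d(\alpha(Y)-\beta(X))\bigr).$$ **Theorem.** The induced structure $F$ of $N$ is a classical CRF structure if and only if $$d\Omega(X,Y,Z)=d\Omega(JX,JY,Z)\quad\text{and}\quad\gamma\bigl(b(FX,FY)-b(X,Y),\,JZ\bigr)=0$$ at every point of $N$, for all $X,Y\in TN\cap J(TN)$ and all $Z\in TN\cap J(\nu N)$. -/

import Mathlib

open Bundle VectorField FiberBundle
open scoped Manifold ContDiff

namespace CRSub

/-! ### The Levi-Civita connection -/

theorem exists_clm_of_bilin {V : Type*} [NormedAddCommGroup V] [InnerProductSpace ℝ V]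
    [FiniteDimensional ℝ V] (B : V →L[ℝ] V →L[ℝ] ℝ) :
    ∃ A : V →L[ℝ] V, ∀ u w, inner ℝ (A u) w = B u w := by
  have : CompleteSpace V := FiniteDimensional.complete ℝ V
  refine ⟨LinearMap.toContinuousLinearMap
    { toFun := fun u ↦ (InnerProductSpace.toDual ℝ V).symm (B u)
      map_add' := fun u v ↦ by simp
      map_smul' := fun c v ↦ by simp }, fun u w ↦ ?_⟩
  simp [InnerProductSpace.toDual_symm_apply]

section Koszul

set_option linter.unusedSectionVars false

variable {E : Type*} [NormedAddCommGroup E] [NormedSpace ℝ E]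
    {M : Type*} [TopologicalSpace M] [ChartedSpace E M] [IsManifold 𝓘(ℝ, E) ∞ M]
    [RiemannianBundle (fun y : M ↦ TangentSpace 𝓘(ℝ, E) y)]

/-- The right-hand side of the Koszul formula, `2 γ(∇_X Y, Z)`; it only serves to prove that the
Levi-Civita connection exists. -/
noncomputable def koszul
    (X Y Z : Π y : M, TangentSpace 𝓘(ℝ, E) y) (x : M) : ℝ :=
  mvfderiv 𝓘(ℝ, E) (fun y ↦ inner ℝ (Y y) (Z y)) x (X x)
  + mvfderiv 𝓘(ℝ, E) (fun y ↦ inner ℝ (X y) (Z y)) x (Y x)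
  - mvfderiv 𝓘(ℝ, E) (fun y ↦ inner ℝ (X y) (Y y)) x (Z x)
  + inner ℝ (mlieBracket 𝓘(ℝ, E) X Y x) (Z x)
  - inner ℝ (mlieBracket 𝓘(ℝ, E) X Z x) (Y x)
  - inner ℝ (mlieBracket 𝓘(ℝ, E) Y Z x) (X x)

variable [IsContMDiffRiemannianBundle 𝓘(ℝ, E) ∞ E (fun y : M ↦ TangentSpace 𝓘(ℝ, E) y)]
  {x : M} {X Y Z W : Π y : M, TangentSpace 𝓘(ℝ, E) y} {f : M → ℝ}

theorem mdiffAt_inner (hX : MDiffAt (T% X) x) (hY : MDiffAt (T% Y) x) :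
    MDiffAt (fun y ↦ inner ℝ (X y) (Y y)) x :=
  MDifferentiableAt.inner_bundle (IB := 𝓘(ℝ, E)) (F := E) (b := fun y : M ↦ y)
    (E := fun y : M ↦ TangentSpace 𝓘(ℝ, E) y) hX hY

theorem d_inner_add (hX : MDiffAt (T% X) x) (hY : MDiffAt (T% Y) x) (hZ : MDiffAt (T% Z) x)
    (v : TangentSpace 𝓘(ℝ, E) x) :
    mvfderiv 𝓘(ℝ, E) (fun y ↦ inner ℝ ((X + Y) y) (Z y)) x v =
    mvfderiv 𝓘(ℝ, E) (fun y ↦ inner ℝ (X y) (Z y)) x v +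
    mvfderiv 𝓘(ℝ, E) (fun y ↦ inner ℝ (Y y) (Z y)) x v := by
  simp only [Pi.add_apply, inner_add_left]
  rw [mvfderiv_fun_add (mdiffAt_inner hX hZ) (mdiffAt_inner hY hZ)]
  rfl

theorem d_inner_smul (hf : MDiffAt f x) (hX : MDiffAt (T% X) x) (hZ : MDiffAt (T% Z) x)
    (v : TangentSpace 𝓘(ℝ, E) x) :
    mvfderiv 𝓘(ℝ, E) (fun y ↦ inner ℝ ((f • X) y) (Z y)) x v =
    f x * mvfderiv 𝓘(ℝ, E) (fun y ↦ inner ℝ (X y) (Z y)) x v +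
    mvfderiv 𝓘(ℝ, E) f x v * inner ℝ (X x) (Z x) := by
  simp only [Pi.smul_apply', inner_smul_left]
  simp only [conj_trivial]
  rw [mvfderiv_fun_mul hf (mdiffAt_inner hX hZ)]
  simp; ring

theorem d_inner_comm (X Y : Π y : M, TangentSpace 𝓘(ℝ, E) y) :
    mvfderiv 𝓘(ℝ, E) (fun y ↦ inner ℝ (X y) (Y y)) x =
      mvfderiv 𝓘(ℝ, E) (fun y ↦ inner ℝ (Y y) (X y)) x := by
  simp only [real_inner_comm]

theorem koszul_metric (X Y Z : Π y : M, TangentSpace 𝓘(ℝ, E) y) : koszul X Y Z x + koszul X Z Y x =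
    2 * mvfderiv 𝓘(ℝ, E) (fun y ↦ inner ℝ (Y y) (Z y)) x (X x) := by
  simp only [koszul, d_inner_comm Z Y, mlieBracket_swap_apply (V := Z) (W := Y), inner_neg_left]
  ring

theorem koszul_torsion (X Y Z : Π y : M, TangentSpace 𝓘(ℝ, E) y) : koszul X Y Z x - koszul Y X Z x =
    2 * inner ℝ (mlieBracket 𝓘(ℝ, E) X Y x) (Z x) := by
  simp only [koszul, d_inner_comm Y X, mlieBracket_swap_apply (V := Y) (W := X), inner_neg_left]
  ring

variable [CompleteSpace E]

theorem koszul_add_right (hX : MDiffAt (T% X) x) (hY : MDiffAt (T% Y) x) (hZ : MDiffAt (T% Z) x)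
    (hW : MDiffAt (T% W) x) : koszul X Y (Z + W) x = koszul X Y Z x + koszul X Y W x := by
  simp only [koszul, d_inner_comm X (Z + W), d_inner_comm Y (Z + W), d_inner_add hZ hW hX,
    d_inner_add hZ hW hY, mlieBracket_add_right hZ hW]
  simp only [Pi.add_apply, inner_add_left, inner_add_right, map_add, d_inner_comm Z, d_inner_comm W]
  ring

theorem koszul_smul_right (hf : MDiffAt f x) (hX : MDiffAt (T% X) x) (hY : MDiffAt (T% Y) x)
    (hZ : MDiffAt (T% Z) x) : koszul X Y (f • Z) x = f x * koszul X Y Z x := by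
  simp only [koszul, d_inner_comm X (f • Z), d_inner_comm Y (f • Z), d_inner_smul hf hZ hX,
    d_inner_smul hf hZ hY, mlieBracket_smul_right hf hZ]
  simp only [Pi.smul_apply', inner_add_left, inner_smul_left, inner_smul_right, map_smul,
    d_inner_comm Z, conj_trivial, smul_eq_mul, real_inner_comm (Z x)]
  ring

theorem koszul_add_mid (hX : MDiffAt (T% X) x) (hY : MDiffAt (T% Y) x) (hZ : MDiffAt (T% Z) x)
    (hW : MDiffAt (T% W) x) : koszul X (Y + W) Z x = koszul X Y Z x + koszul X W Z x := by
  have h1 := koszul_metric (x := x) X (Y + W) Z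
  have h2 := koszul_metric (x := x) X Y Z
  have h3 := koszul_metric (x := x) X W Z
  rw [d_inner_add hY hW hZ, koszul_add_right hX hZ hY hW] at h1
  linarith

theorem koszul_smul_mid (hf : MDiffAt f x) (hX : MDiffAt (T% X) x) (hY : MDiffAt (T% Y) x)
    (hZ : MDiffAt (T% Z) x) : koszul X (f • Y) Z x = f x * koszul X Y Z x +
      2 * (mvfderiv 𝓘(ℝ, E) f x (X x) * inner ℝ (Y x) (Z x)) := by
  have h1 := koszul_metric (x := x) X (f • Y) Z
  have h2 := koszul_metric (x := x) X Y Z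
  rw [d_inner_smul hf hY hZ, koszul_smul_right hf hX hZ hY] at h1
  linear_combination h1 - f x * h2

theorem koszul_add_left (hX : MDiffAt (T% X) x) (hY : MDiffAt (T% Y) x) (hZ : MDiffAt (T% Z) x)
    (hW : MDiffAt (T% W) x) : koszul (X + W) Y Z x = koszul X Y Z x + koszul W Y Z x := by
  have h1 := koszul_torsion (x := x) (X + W) Y Z
  have h2 := koszul_torsion (x := x) X Y Z
  have h3 := koszul_torsion (x := x) W Y Z
  rw [koszul_add_mid hY hX hZ hW, mlieBracket_add_left hX hW, inner_add_left] at h1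
  linarith

theorem koszul_smul_left (hf : MDiffAt f x) (hX : MDiffAt (T% X) x) (hY : MDiffAt (T% Y) x)
    (hZ : MDiffAt (T% Z) x) : koszul (f • X) Y Z x = f x * koszul X Y Z x := by
  have h1 := koszul_torsion (x := x) (f • X) Y Z
  have h2 := koszul_torsion (x := x) X Y Z
  rw [koszul_smul_mid hf hY hX hZ, mlieBracket_smul_left hf hX, inner_add_left,
    inner_smul_left, inner_smul_left, conj_trivial, conj_trivial] at h1
  linear_combination h1 - f x * h2

end Koszul


/-- A connection on the tangent bundle is the Levi-Civita connection if it is metric and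
torsion-free. -/
def IsLeviCivita {E : Type*} [NormedAddCommGroup E] [NormedSpace ℝ E] [FiniteDimensional ℝ E]
    {M : Type*} [TopologicalSpace M] [ChartedSpace E M] [IsManifold 𝓘(ℝ, E) ∞ M]
    [RiemannianBundle (fun y : M ↦ TangentSpace 𝓘(ℝ, E) y)]
    [IsContMDiffRiemannianBundle 𝓘(ℝ, E) ∞ E (fun y : M ↦ TangentSpace 𝓘(ℝ, E) y)]
    (cov : CovariantDerivative 𝓘(ℝ, E) E (fun y : M ↦ TangentSpace 𝓘(ℝ, E) y)) : Prop :=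
  haveI : CompleteSpace E := FiniteDimensional.complete ℝ E
  cov.IsMetricCompatible ∧ cov.torsion = 0

/-- Existence of the Levi-Civita connection: a metric, torsion-free connection on the tangent
bundle. -/
theorem exists_leviCivita {E : Type*} [NormedAddCommGroup E] [NormedSpace ℝ E]
    [FiniteDimensional ℝ E] {M : Type*} [TopologicalSpace M] [ChartedSpace E M] [IsManifold 𝓘(ℝ, E) ∞ M]
    [RiemannianBundle (fun y : M ↦ TangentSpace 𝓘(ℝ, E) y)]
    [IsContMDiffRiemannianBundle 𝓘(ℝ, E) ∞ E (fun y : M ↦ TangentSpace 𝓘(ℝ, E) y)] :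
    ∃ cov : CovariantDerivative 𝓘(ℝ, E) E (fun y : M ↦ TangentSpace 𝓘(ℝ, E) y),
      IsLeviCivita cov := by
  classical
  have : CompleteSpace E := FiniteDimensional.complete ℝ E
  have key : ∀ (Y : Π y : M, TangentSpace 𝓘(ℝ, E) y) (x : M),
      ∃ A : TangentSpace 𝓘(ℝ, E) x →L[ℝ] TangentSpace 𝓘(ℝ, E) x, MDiffAt (T% Y) x →
        ∀ X Z : Π y : M, TangentSpace 𝓘(ℝ, E) y, MDiffAt (T% X) x → MDiffAt (T% Z) x →
          2 * inner ℝ (A (X x)) (Z x) = koszul X Y Z x := by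
    intro Y x
    by_cases hY : MDiffAt (T% Y) x
    · have h1 : ∀ Z : Π y : M, TangentSpace 𝓘(ℝ, E) y, MDiffAt (T% Z) x →
          TensorialAt 𝓘(ℝ, E) E (fun X ↦ koszul X Y Z x) x := fun Z hZ ↦
        ⟨fun hf hX ↦ koszul_smul_left hf hX hY hZ, fun hX hW ↦ koszul_add_left hX hY hZ hW⟩
      have h2 : ∀ X : Π y : M, TangentSpace 𝓘(ℝ, E) y, MDiffAt (T% X) x →
          TensorialAt 𝓘(ℝ, E) E (fun Z ↦ koszul X Y Z x) x := fun X hX ↦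
        ⟨fun hf hZ ↦ koszul_smul_right hf hX hY hZ, fun hZ hW ↦ koszul_add_right hX hY hZ hW⟩
      have : FiniteDimensional ℝ (TangentSpace 𝓘(ℝ, E) x) := inferInstanceAs (FiniteDimensional ℝ E)
      obtain ⟨A, hA⟩ := exists_clm_of_bilin
        (TensorialAt.mkHom₂ (fun X Z ↦ koszul X Y Z x) x h1 h2)
      refine ⟨(1 / 2 : ℝ) • A, fun _ X Z hX hZ ↦ ?_⟩
      rw [← TensorialAt.mkHom₂_apply h1 h2 hX hZ, ← hA]
      simp [inner_smul_left]
    · exact ⟨0, fun h ↦ absurd h hY⟩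
  choose A hA using key
  have ext_inner : ∀ {x : M} {u v : TangentSpace 𝓘(ℝ, E) x},
      (∀ Z : Π y : M, TangentSpace 𝓘(ℝ, E) y, MDiffAt (T% Z) x →
        inner ℝ u (Z x) = inner ℝ v (Z x)) → u = v := by
    intro x u v h
    refine ext_inner_right ℝ fun w ↦ ?_
    simpa using h (extend E w) (mdifferentiableAt_extend ..)
  have ext_clm : ∀ {x : M} {S T : TangentSpace 𝓘(ℝ, E) x →L[ℝ] TangentSpace 𝓘(ℝ, E) x},
      (∀ X : Π y : M, TangentSpace 𝓘(ℝ, E) y, MDiffAt (T% X) x → S (X x) = T (X x)) → S = T := by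
    intro x S T h
    ext w
    simpa using h (extend E w) (mdifferentiableAt_extend ..)
  let cov : CovariantDerivative 𝓘(ℝ, E) E (fun y : M ↦ TangentSpace 𝓘(ℝ, E) y) :=
    { toFun := A
      isCovariantDerivativeOnUniv :=
      { add := by
          intro σ τ x hσ hτ _
          have hs : MDiffAt (T% (σ + τ)) x := mdifferentiableAt_add_section hσ hτ
          refine ext_clm fun X hX ↦ ext_inner fun Z hZ ↦ ?_
          have h1 := hA _ x hs X Z hX hZ
          have h2 := hA _ x hσ X Z hX hZ
          have h3 := hA _ x hτ X Z hX hZ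
          rw [koszul_add_mid hX hσ hZ hτ] at h1
          rw [add_apply, inner_add_left]
          linarith
        leibniz := by
          intro σ f x hσ hf _
          have hs : MDiffAt (T% (f • σ)) x := hf.smul_section hσ
          refine ext_clm fun X hX ↦ ext_inner fun Z hZ ↦ ?_
          have h1 := hA _ x hs X Z hX hZ
          have h2 := hA _ x hσ X Z hX hZ
          rw [koszul_smul_mid hf hX hσ hZ] at h1
          simp only [add_apply, inner_add_left, smul_apply,
            ContinuousLinearMap.smulRight_apply, inner_smul_left, conj_trivial]
          linear_combination h1 / 2 - f x / 2 * h2 } }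
  refine ⟨cov, ?_, ?_⟩
  · rw [CovariantDerivative.isMetricCompatible_iff]
    intro x X σ τ hX hσ hτ
    have h1 := hA _ x hσ X τ hX hτ
    have h2 := hA _ x hτ X σ hX hσ
    have h3 := koszul_metric (x := x) X σ τ
    change _ = inner ℝ (A σ x (X x)) (τ x) + inner ℝ (σ x) (A τ x (X x))
    rw [real_inner_comm _ (σ x)]
    linarith
  · rw [CovariantDerivative.torsion_eq_zero_iff]
    intro X Y x hX hY
    refine ext_inner fun Z hZ ↦ ?_
    have h1 := hA _ x hY X Z hX hZ
    have h2 := hA _ x hX Y Z hY hZ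
    have h3 := koszul_torsion (x := x) X Y Z
    change inner ℝ (A Y x (X x) - A X x (Y x)) (Z x) = _
    rw [inner_sub_left]
    linarith

/-- The Levi-Civita connection: the metric, torsion-free connection on the tangent bundle (its
values on differentiable vector fields are determined by these two properties). In Mathlib's
argument order, `leviCivita E M Y y u` is `∇_u Y` at `y`. -/
noncomputable def leviCivita (E : Type*) [NormedAddCommGroup E] [NormedSpace ℝ E]
    [FiniteDimensional ℝ E] (M : Type*) [TopologicalSpace M] [ChartedSpace E M]
    [IsManifold 𝓘(ℝ, E) ∞ M] [RiemannianBundle (fun y : M ↦ TangentSpace 𝓘(ℝ, E) y)]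
    [IsContMDiffRiemannianBundle 𝓘(ℝ, E) ∞ E (fun y : M ↦ TangentSpace 𝓘(ℝ, E) y)] :
    CovariantDerivative 𝓘(ℝ, E) E (fun y : M ↦ TangentSpace 𝓘(ℝ, E) y) :=
  (exists_leviCivita (E := E) (M := M)).choose

theorem leviCivita_spec (E : Type*) [NormedAddCommGroup E] [NormedSpace ℝ E]
    [FiniteDimensional ℝ E] (M : Type*) [TopologicalSpace M] [ChartedSpace E M]
    [IsManifold 𝓘(ℝ, E) ∞ M] [RiemannianBundle (fun y : M ↦ TangentSpace 𝓘(ℝ, E) y)]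
    [IsContMDiffRiemannianBundle 𝓘(ℝ, E) ∞ E (fun y : M ↦ TangentSpace 𝓘(ℝ, E) y)] :
    IsLeviCivita (leviCivita E M) :=
  (exists_leviCivita (E := E) (M := M)).choose_spec

/-! ### Hermitian structures and the exterior derivative of the Kähler form -/

section Hermitian

variable {E : Type*} [NormedAddCommGroup E] [NormedSpace ℝ E]
  {M : Type*} [TopologicalSpace M] [ChartedSpace E M] [IsManifold 𝓘(ℝ, E) ∞ M]

/-- `(M, γ, J)` is a Hermitian manifold, where `γ` is the given Riemannian metric of `M`: `J` is a
smooth, `γ`-orthogonal almost complex structure with vanishing Nijenhuis tensor. -/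
structure IsHermitianStructure [RiemannianBundle (fun y : M ↦ TangentSpace 𝓘(ℝ, E) y)]
    (J : Π y : M, TangentSpace 𝓘(ℝ, E) y →L[ℝ] TangentSpace 𝓘(ℝ, E) y) : Prop where
  contMDiff : ContMDiff 𝓘(ℝ, E) (𝓘(ℝ, E).prod 𝓘(ℝ, E →L[ℝ] E)) ∞
    (fun y ↦ (TotalSpace.mk' (E →L[ℝ] E) y (J y) :
      TotalSpace (E →L[ℝ] E)
        (fun y : M ↦ TangentSpace 𝓘(ℝ, E) y →L[ℝ] TangentSpace 𝓘(ℝ, E) y)))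
  sq_eq_neg : ∀ (y : M) (v : TangentSpace 𝓘(ℝ, E) y), J y (J y v) = -v
  inner_map_map : ∀ (y : M) (u v : TangentSpace 𝓘(ℝ, E) y),
    inner ℝ (J y u) (J y v) = inner ℝ u v
  nijenhuis_eq_zero : ∀ (X Y : Π y : M, TangentSpace 𝓘(ℝ, E) y) (y : M),
    CMDiffAt ∞ (T% X) y → CMDiffAt ∞ (T% Y) y →
      mlieBracket 𝓘(ℝ, E) (fun z ↦ J z (X z)) (fun z ↦ J z (Y z)) y
        - J y (mlieBracket 𝓘(ℝ, E) (fun z ↦ J z (X z)) Y y)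
        - J y (mlieBracket 𝓘(ℝ, E) X (fun z ↦ J z (Y z)) y)
        - mlieBracket 𝓘(ℝ, E) X Y y = 0

/-- The Kähler form `Ω(X, Y) = γ(J X, Y)`. -/
noncomputable def kahlerForm [RiemannianBundle (fun y : M ↦ TangentSpace 𝓘(ℝ, E) y)]
    (J : Π y : M, TangentSpace 𝓘(ℝ, E) y →L[ℝ] TangentSpace 𝓘(ℝ, E) y)
    (y : M) (u v : TangentSpace 𝓘(ℝ, E) y) : ℝ :=
  inner ℝ (J y u) v

/-- The Cartan formula
`X η(Y, Z) - Y η(X, Z) + Z η(X, Y) - η([X, Y], Z) + η([X, Z], Y) - η([Y, Z], X)` for the exterior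
derivative of a 2-form, evaluated on vector fields. -/
noncomputable def cartanTwo (η : Π y : M, TangentSpace 𝓘(ℝ, E) y → TangentSpace 𝓘(ℝ, E) y → ℝ)
    (X Y Z : Π y : M, TangentSpace 𝓘(ℝ, E) y) (y : M) : ℝ :=
  mvfderiv 𝓘(ℝ, E) (fun z ↦ η z (Y z) (Z z)) y (X y)
  - mvfderiv 𝓘(ℝ, E) (fun z ↦ η z (X z) (Z z)) y (Y y)
  + mvfderiv 𝓘(ℝ, E) (fun z ↦ η z (X z) (Y z)) y (Z y)
  - η y (mlieBracket 𝓘(ℝ, E) X Y y) (Z y)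
  + η y (mlieBracket 𝓘(ℝ, E) X Z y) (Y y)
  - η y (mlieBracket 𝓘(ℝ, E) Y Z y) (X y)

/-- The exterior derivative `dη(u, v, w)` of a 2-form at a point: the Cartan formula applied to
the (locally smooth) extensions of the three tangent vectors by Mathlib's `FiberBundle.extend`. -/
noncomputable def extDerivTwo (η : Π y : M, TangentSpace 𝓘(ℝ, E) y → TangentSpace 𝓘(ℝ, E) y → ℝ)
    (y : M) (u v w : TangentSpace 𝓘(ℝ, E) y) : ℝ :=
  cartanTwo η (extend E u) (extend E v) (extend E w) y

end Hermitian

/-! ### Immersed submanifolds and the second fundamental form -/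

section Submanifold

variable {E : Type*} [NormedAddCommGroup E] [NormedSpace ℝ E]
  {M : Type*} [TopologicalSpace M] [ChartedSpace E M] [IsManifold 𝓘(ℝ, E) ∞ M]
  {E' : Type*} [NormedAddCommGroup E'] [NormedSpace ℝ E']
  {N : Type*} [TopologicalSpace N] [ChartedSpace E' N] [IsManifold 𝓘(ℝ, E') ∞ N]

/-- The tangent space of the submanifold, as a subspace `dι(T_x N)` of `T_{ι x} M`. -/
noncomputable def tangentImage (E E' : Type*) [NormedAddCommGroup E] [NormedSpace ℝ E]
    [NormedAddCommGroup E'] [NormedSpace ℝ E'] {M N : Type*} [TopologicalSpace M]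
    [ChartedSpace E M] [TopologicalSpace N] [ChartedSpace E' N] (ι : N → M) (x : N) :
    Submodule ℝ (TangentSpace 𝓘(ℝ, E) (ι x)) :=
  LinearMap.range (mfderiv 𝓘(ℝ, E') 𝓘(ℝ, E) ι x).toLinearMap

/-- The normal space `ν_x N`, the `γ`-orthogonal complement of `dι(T_x N)` in `T_{ι x} M`. -/
noncomputable def normalSpace (E E' : Type*) [NormedAddCommGroup E] [NormedSpace ℝ E]
    [NormedAddCommGroup E'] [NormedSpace ℝ E'] {M N : Type*} [TopologicalSpace M]
    [ChartedSpace E M] [IsManifold 𝓘(ℝ, E) ∞ M] [TopologicalSpace N] [ChartedSpace E' N]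
    [RiemannianBundle (fun y : M ↦ TangentSpace 𝓘(ℝ, E) y)] (ι : N → M) (x : N) :
    Submodule ℝ (TangentSpace 𝓘(ℝ, E) (ι x)) :=
  (tangentImage E E' ι x)ᗮ

/-- The covariant derivative `∇_u W` at `x`, along `ι`, of a vector field `W` of `M` along `ι`.
In the coordinate frame `e_i` of `M` around `ι x` write `W = ∑ i, w_i (e_i ∘ ι)`; then
`∇_u W = ∑ i, (dw_i(u) e_i + w_i(x) ∇_{dι u} e_i)`, where `∇` is the Levi-Civita connection. -/
noncomputable def covAlong [FiniteDimensional ℝ E]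
    [RiemannianBundle (fun y : M ↦ TangentSpace 𝓘(ℝ, E) y)]
    [IsContMDiffRiemannianBundle 𝓘(ℝ, E) ∞ E (fun y : M ↦ TangentSpace 𝓘(ℝ, E) y)]
    (ι : N → M) (W : Π x : N, TangentSpace 𝓘(ℝ, E) (ι x)) (x : N)
    (u : TangentSpace 𝓘(ℝ, E') x) : TangentSpace 𝓘(ℝ, E) (ι x) :=
  (trivializationAt E (TangentSpace 𝓘(ℝ, E)) (ι x)).symmL ℝ (ι x)
      (mvfderiv 𝓘(ℝ, E') (fun z : N ↦
        (trivializationAt E (TangentSpace 𝓘(ℝ, E)) (ι x)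
          (TotalSpace.mk' E (ι z) (W z))).2) x u)
    + leviCivita E M (extend E (W x)) (ι x) (mfderiv 𝓘(ℝ, E') 𝓘(ℝ, E) ι x u)

/-- The second fundamental form `b(u, v)`: the normal component of `∇_u (dι V)`, where `V` is a
local extension of `v` to a vector field of `N`. -/
noncomputable def secondFundamentalForm [FiniteDimensional ℝ E]
    [RiemannianBundle (fun y : M ↦ TangentSpace 𝓘(ℝ, E) y)]
    [IsContMDiffRiemannianBundle 𝓘(ℝ, E) ∞ E (fun y : M ↦ TangentSpace 𝓘(ℝ, E) y)]
    (ι : N → M) (x : N) (u v : TangentSpace 𝓘(ℝ, E') x) : TangentSpace 𝓘(ℝ, E) (ι x) :=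
  haveI : FiniteDimensional ℝ (TangentSpace 𝓘(ℝ, E) (ι x)) :=
    inferInstanceAs (FiniteDimensional ℝ E)
  (normalSpace E E' ι x).starProjection
    (covAlong ι (fun z ↦ mfderiv 𝓘(ℝ, E') 𝓘(ℝ, E) ι z (extend E' v z)) x u)

/-! ### CR-submanifolds and the induced F structure -/

/-- `TN ∩ J(TN)` at `x`, as a subspace of `T_x N`. -/
noncomputable def holoDist
    (J : Π y : M, TangentSpace 𝓘(ℝ, E) y →L[ℝ] TangentSpace 𝓘(ℝ, E) y) (ι : N → M) (x : N) :
    Submodule ℝ (TangentSpace 𝓘(ℝ, E') x) :=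
  ((tangentImage E E' ι x).map (J (ι x)).toLinearMap).comap
    (mfderiv 𝓘(ℝ, E') 𝓘(ℝ, E) ι x).toLinearMap

/-- `TN ∩ J(νN)` at `x`, as a subspace of `T_x N`. -/
noncomputable def realDist [RiemannianBundle (fun y : M ↦ TangentSpace 𝓘(ℝ, E) y)]
    (J : Π y : M, TangentSpace 𝓘(ℝ, E) y →L[ℝ] TangentSpace 𝓘(ℝ, E) y) (ι : N → M) (x : N) :
    Submodule ℝ (TangentSpace 𝓘(ℝ, E') x) :=
  ((normalSpace E E' ι x).map (J (ι x)).toLinearMap).comap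
    (mfderiv 𝓘(ℝ, E') 𝓘(ℝ, E) ι x).toLinearMap

/-- An (immersed) CR-submanifold: `TN = (TN ∩ J(TN)) ⊕ (TN ∩ J(νN))`, with terms of constant rank. -/
structure IsCRSubmanifold [RiemannianBundle (fun y : M ↦ TangentSpace 𝓘(ℝ, E) y)]
    (J : Π y : M, TangentSpace 𝓘(ℝ, E) y →L[ℝ] TangentSpace 𝓘(ℝ, E) y) (ι : N → M) : Prop where
  isImmersion : Manifold.IsImmersion 𝓘(ℝ, E') 𝓘(ℝ, E) ∞ ι
  isCompl : ∀ x : N, IsCompl (holoDist (E' := E') J ι x) (realDist (E' := E') J ι x)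
  rank_holoDist : ∃ r : ℕ, ∀ x : N, Module.finrank ℝ (holoDist (E' := E') J ι x) = r
  rank_realDist : ∃ r : ℕ, ∀ x : N, Module.finrank ℝ (realDist (E' := E') J ι x) = r

set_option linter.unusedSectionVars false in
/-- The differential of an immersion is injective. -/
theorem injective_mfderiv {ι : N → M} (hι : Manifold.IsImmersion 𝓘(ℝ, E') 𝓘(ℝ, E) ∞ ι) (x : N) :
    Function.Injective (mfderiv 𝓘(ℝ, E') 𝓘(ℝ, E) ι x) := by
  have h := hι.isImmersionAt x
  set φ := h.domChart.extend 𝓘(ℝ, E') with hφ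
  set ψ := h.codChart.extend 𝓘(ℝ, E) with hψ
  have hφm : MDifferentiableAt 𝓘(ℝ, E') 𝓘(ℝ, E') φ x :=
    (h.domChart.contMDiffAt_extend h.domChart_mem_maximalAtlas
      h.mem_domChart_source).mdifferentiableAt (by simp)
  have hψm : MDifferentiableAt 𝓘(ℝ, E) 𝓘(ℝ, E) ψ (ι x) :=
    (h.codChart.contMDiffAt_extend h.codChart_mem_maximalAtlas
      h.mem_codChart_source).mdifferentiableAt (by simp)
  have hsrc : x ∈ φ.source := by
    rw [hφ, OpenPartialHomeomorph.extend_source]; exact h.mem_domChart_source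
  have hopen : φ.target ∈ nhds (φ x) := by
    have : IsOpen φ.target := by simpa [hφ] using h.domChart.open_target
    exact this.mem_nhds (φ.map_source hsrc)
  have hsm : MDifferentiableAt 𝓘(ℝ, E') 𝓘(ℝ, E') φ.symm (φ x) :=
    ((contMDiffOn_extend_symm h.domChart_mem_maximalAtlas).contMDiffAt
      (by simpa [hφ] using hopen)).mdifferentiableAt (by simp)
  have hιm : MDifferentiableAt 𝓘(ℝ, E') 𝓘(ℝ, E) ι x := h.contMDiffAt.mdifferentiableAt (by simp)
  -- a differentiable local left inverse of `ι`
  let L : E → E' := fun e ↦ (h.equiv.symm e).1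
  have hL : MDifferentiableAt 𝓘(ℝ, E) 𝓘(ℝ, E') L (ψ (ι x)) := by
    have : Differentiable ℝ L := by fun_prop
    exact this.differentiableAt.mdifferentiableAt
  have hLx : L (ψ (ι x)) = φ x := by
    have := h.writtenInCharts (φ.map_source hsrc)
    simp only [Function.comp_apply] at this
    rw [φ.left_inv hsrc] at this
    have hψx : ψ (ι x) = h.equiv (φ x, 0) := this
    simp only [L, hψx, ContinuousLinearEquiv.symm_apply_apply]
  have hloc : (φ.symm ∘ L ∘ ψ ∘ ι) =ᶠ[nhds x] id := by
    have hs : φ.source ∈ nhds x := by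
      rw [hφ, OpenPartialHomeomorph.extend_source]
      exact h.domChart.open_source.mem_nhds h.mem_domChart_source
    filter_upwards [hs] with z hz
    have := h.writtenInCharts (φ.map_source hz)
    simp only [Function.comp_apply] at this
    rw [φ.left_inv hz] at this
    have hψz : ψ (ι z) = h.equiv (φ z, 0) := this
    simp only [Function.comp_apply, L, hψz, ContinuousLinearEquiv.symm_apply_apply,
      φ.left_inv hz, id]
  have hG : MDifferentiableAt 𝓘(ℝ, E) 𝓘(ℝ, E') (φ.symm ∘ L ∘ ψ) (ι x) := by
    refine MDifferentiableAt.comp (I' := 𝓘(ℝ, E')) (ι x) ?_ (hL.comp (ι x) hψm)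
    simpa [hLx] using hsm
  have hcomp := mfderiv_comp x hG hιm
  have hid : mfderiv 𝓘(ℝ, E') 𝓘(ℝ, E') ((φ.symm ∘ L ∘ ψ) ∘ ι) x =
      mfderiv 𝓘(ℝ, E') 𝓘(ℝ, E') (id : N → N) x := Filter.EventuallyEq.mfderiv_eq hloc
  intro u v huv
  have h3 : ∀ w : TangentSpace 𝓘(ℝ, E') x,
      mfderiv 𝓘(ℝ, E) 𝓘(ℝ, E') (φ.symm ∘ L ∘ ψ) (ι x) (mfderiv 𝓘(ℝ, E') 𝓘(ℝ, E) ι x w) =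
        (show E' from w) := by
    intro w
    have := congrArg (fun T ↦ (show E' from T w)) (hcomp.symm.trans hid)
    simpa using! this
  have := congrArg (mfderiv 𝓘(ℝ, E) 𝓘(ℝ, E') (φ.symm ∘ L ∘ ψ) (ι x)) huv
  exact (h3 u).symm.trans (this.trans (h3 v))

/-- Existence and uniqueness of the value at `x` of the induced F structure. -/
theorem existsUnique_inducedF [FiniteDimensional ℝ E']
    [RiemannianBundle (fun y : M ↦ TangentSpace 𝓘(ℝ, E) y)]
    {J : Π y : M, TangentSpace 𝓘(ℝ, E) y →L[ℝ] TangentSpace 𝓘(ℝ, E) y} {ι : N → M}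
    (hJ : IsHermitianStructure J) (hN : IsCRSubmanifold (E' := E') J ι) (x : N) :
    ∃! F : TangentSpace 𝓘(ℝ, E') x →L[ℝ] TangentSpace 𝓘(ℝ, E') x,
      (∀ v ∈ holoDist (E' := E') J ι x,
        mfderiv 𝓘(ℝ, E') 𝓘(ℝ, E) ι x (F v) = J (ι x) (mfderiv 𝓘(ℝ, E') 𝓘(ℝ, E) ι x v)) ∧
      ∀ v ∈ realDist (E' := E') J ι x, F v = 0 := by
  have : FiniteDimensional ℝ (TangentSpace 𝓘(ℝ, E') x) := inferInstanceAs (FiniteDimensional ℝ E')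
  have : T2Space (TangentSpace 𝓘(ℝ, E') x) := inferInstanceAs (T2Space E')
  have hinj := injective_mfderiv hN.isImmersion x
  have hD : ∀ v : holoDist (E' := E') J ι x, J (ι x) (mfderiv 𝓘(ℝ, E') 𝓘(ℝ, E) ι x v) ∈
      LinearMap.range (mfderiv 𝓘(ℝ, E') 𝓘(ℝ, E) ι x).toLinearMap := by
    rintro ⟨v, _, ⟨w, rfl⟩, hv⟩
    refine ⟨-w, ?_⟩
    simp only [ContinuousLinearMap.coe_coe] at hv ⊢
    rw [← hv, hJ.sq_eq_neg, map_neg]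
  let e := LinearEquiv.ofInjective (mfderiv 𝓘(ℝ, E') 𝓘(ℝ, E) ι x).toLinearMap hinj
  let g : holoDist (E' := E') J ι x →ₗ[ℝ] TangentSpace 𝓘(ℝ, E') x :=
    e.symm.toLinearMap ∘ₗ LinearMap.codRestrict _
      ((J (ι x)).toLinearMap ∘ₗ (mfderiv 𝓘(ℝ, E') 𝓘(ℝ, E) ι x).toLinearMap ∘ₗ
        (holoDist (E' := E') J ι x).subtype) hD
  have hg : ∀ v, mfderiv 𝓘(ℝ, E') 𝓘(ℝ, E) ι x (g v) =
      J (ι x) (mfderiv 𝓘(ℝ, E') 𝓘(ℝ, E) ι x v) := by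
    intro v
    exact LinearEquiv.ofInjective_symm_apply (f := (mfderiv 𝓘(ℝ, E') 𝓘(ℝ, E) ι x).toLinearMap)
      (h := hinj) ⟨_, hD v⟩
  refine ⟨LinearMap.toContinuousLinearMap (LinearMap.ofIsCompl (hN.isCompl x) g 0),
    ⟨fun v hv ↦ ?_, fun v hv ↦ ?_⟩, fun F ⟨h1, h2⟩ ↦ ?_⟩
  · have := LinearMap.ofIsCompl_apply_left (φ := g) (ψ := 0) (hN.isCompl x) ⟨v, hv⟩
    simp only [LinearMap.coe_toContinuousLinearMap'] at this ⊢
    rw [this, hg]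
  · have := LinearMap.ofIsCompl_apply_right (φ := g) (ψ := 0) (hN.isCompl x) ⟨v, hv⟩
    simpa using! this
  · ext v
    have := LinearMap.ofIsCompl_eq (φ := g) (ψ := 0) (χ := F.toLinearMap) (hN.isCompl x)
      (fun u ↦ hinj ?_) (fun u ↦ (h2 u u.2).symm)
    · exact congrArg (fun T ↦ T v) this.symm
    · exact (hg u).trans (h1 u u.2).symm

/-- The induced F structure of a CR-submanifold: the unique field `F` of endomorphisms of `TN` with
`F = J` on `TN ∩ J(TN)` and `F = 0` on `TN ∩ J(νN)`. -/
noncomputable def inducedF [FiniteDimensional ℝ E']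
    [RiemannianBundle (fun y : M ↦ TangentSpace 𝓘(ℝ, E) y)]
    {J : Π y : M, TangentSpace 𝓘(ℝ, E) y →L[ℝ] TangentSpace 𝓘(ℝ, E) y} {ι : N → M}
    (hJ : IsHermitianStructure J) (hN : IsCRSubmanifold (E' := E') J ι) (x : N) :
    TangentSpace 𝓘(ℝ, E') x →L[ℝ] TangentSpace 𝓘(ℝ, E') x :=
  (existsUnique_inducedF hJ hN x).choose

end Submanifold

/-! ### Classical CRF structures -/

section CRF

variable (E' : Type*) [NormedAddCommGroup E'] [NormedSpace ℝ E']
  (N : Type*) [TopologicalSpace N] [ChartedSpace E' N] [IsManifold 𝓘(ℝ, E') ∞ N]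

/-- A section `(A + iB, α)` of the complexified bundle `T^c N ⊕ T^{*c} N`. A complex vector field
is given by its real and imaginary part, a complex 1-form by its values on real vectors. -/
structure GenField where
  re : Π x : N, TangentSpace 𝓘(ℝ, E') x
  im : Π x : N, TangentSpace 𝓘(ℝ, E') x
  form : Π x : N, TangentSpace 𝓘(ℝ, E') x →L[ℝ] ℂ

variable {E' N}

/-- Smoothness on `U` of a section of the complexified bundle `T^c N ⊕ T^{*c} N`. -/
structure GenField.IsSmoothOn (S : GenField E' N) (U : Set N) :
    Prop where
  re : ContMDiffOn 𝓘(ℝ, E') (𝓘(ℝ, E').prod 𝓘(ℝ, E')) ∞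
    (fun x ↦ (TotalSpace.mk' E' x (S.re x) : TangentBundle 𝓘(ℝ, E') N)) U
  im : ContMDiffOn 𝓘(ℝ, E') (𝓘(ℝ, E').prod 𝓘(ℝ, E')) ∞
    (fun x ↦ (TotalSpace.mk' E' x (S.im x) : TangentBundle 𝓘(ℝ, E') N)) U
  form : ContMDiffOn 𝓘(ℝ, E') (𝓘(ℝ, E').prod 𝓘(ℝ, E' →L[ℝ] ℂ)) ∞
    (fun x ↦ (TotalSpace.mk' (E' →L[ℝ] ℂ) x (S.form x) : TotalSpace (E' →L[ℝ] ℂ)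
      (fun x : N ↦ TangentSpace 𝓘(ℝ, E') x →L[ℝ] Bundle.Trivial N ℂ x))) U

/-- The derivative `Z(g)` of a complex function along the complex vector field `Z = A + iB`. -/
noncomputable def GenField.derivFun (S : GenField E' N) (g : N → ℂ) (x : N) : ℂ :=
  mvfderiv 𝓘(ℝ, E') g x (S.re x) + Complex.I * mvfderiv 𝓘(ℝ, E') g x (S.im x)

/-- The Lie derivative `(L_Z β)(w)` of the complex 1-form `β` of `T` along the complex vector field
`Z` of `S`: it is `Z(β(W)) - β([Z, W])` for a local extension `W` of `w`. -/
noncomputable def GenField.lieDeriv (S T : GenField E' N) (x : N) (w : TangentSpace 𝓘(ℝ, E') x) :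
    ℂ :=
  S.derivFun (fun z ↦ T.form z (extend E' w z)) x
    - (T.form x (mlieBracket 𝓘(ℝ, E') S.re (extend E' w) x)
      + Complex.I * T.form x (mlieBracket 𝓘(ℝ, E') S.im (extend E' w) x))

/-- The complex function `β(Z)`, for the complex 1-form `β` of `T` and the complex vector field `Z`
of `S`. -/
noncomputable def GenField.pair (S T : GenField E' N) (x : N) : ℂ :=
  T.form x (S.re x) + Complex.I * T.form x (S.im x)

/-- Real part of the Lie bracket of the complex vector fields of `S` and `T`. -/
noncomputable def GenField.bracketRe (S T : GenField E' N) (x : N) : TangentSpace 𝓘(ℝ, E') x :=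
  mlieBracket 𝓘(ℝ, E') S.re T.re x - mlieBracket 𝓘(ℝ, E') S.im T.im x

/-- Imaginary part of the Lie bracket of the complex vector fields of `S` and `T`. -/
noncomputable def GenField.bracketIm (S T : GenField E' N) (x : N) : TangentSpace 𝓘(ℝ, E') x :=
  mlieBracket 𝓘(ℝ, E') S.re T.im x + mlieBracket 𝓘(ℝ, E') S.im T.re x

/-- The 1-form component `L_Z β - L_{Z'} α + (1/2) d(α(Z') - β(Z))` of the Courant bracket
`[(Z, α), (Z', β)]`, where `S = (Z, α)` and `T = (Z', β)`. -/
noncomputable def GenField.bracketForm (S T : GenField E' N) (x : N)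
    (w : TangentSpace 𝓘(ℝ, E') x) : ℂ :=
  S.lieDeriv T x w - T.lieDeriv S x w
    + (1 / 2) * mvfderiv 𝓘(ℝ, E') (fun z ↦ T.pair S z - S.pair T z) x w

/-- `(a + ib, θ)` lies in the `i`-eigenspace of `(X, α) ↦ (F X, -α ∘ F)`. -/
def IsEigen {x : N} (F : TangentSpace 𝓘(ℝ, E') x →L[ℝ] TangentSpace 𝓘(ℝ, E') x)
    (a b : TangentSpace 𝓘(ℝ, E') x) (θ : TangentSpace 𝓘(ℝ, E') x → ℂ) : Prop :=
  F a = -b ∧ F b = a ∧ ∀ w, -θ (F w) = Complex.I * θ w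

/-- `F` is a classical CRF structure: it is an F structure (smooth, with `F³ + F = 0`), and the
`i`-eigenbundle of the generalized F structure `(X, α) ↦ (F X, -α ∘ F)` on `T^c N ⊕ T^{*c} N` is
closed under Courant brackets (of local sections). -/
structure IsClassicalCRF
    (F : Π x : N, TangentSpace 𝓘(ℝ, E') x →L[ℝ] TangentSpace 𝓘(ℝ, E') x) : Prop where
  contMDiff : ContMDiff 𝓘(ℝ, E') (𝓘(ℝ, E').prod 𝓘(ℝ, E' →L[ℝ] E')) ∞
    (fun x ↦ (TotalSpace.mk' (E' →L[ℝ] E') x (F x) :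
      TotalSpace (E' →L[ℝ] E')
        (fun x : N ↦ TangentSpace 𝓘(ℝ, E') x →L[ℝ] TangentSpace 𝓘(ℝ, E') x)))
  cube_add_self : ∀ (x : N) (v : TangentSpace 𝓘(ℝ, E') x), F x (F x (F x v)) + F x v = 0
  closed : ∀ (U : Set N), IsOpen U → ∀ S T : GenField E' N, S.IsSmoothOn U → T.IsSmoothOn U →
    (∀ x ∈ U, IsEigen (F x) (S.re x) (S.im x) (S.form x)) →
    (∀ x ∈ U, IsEigen (F x) (T.re x) (T.im x) (T.form x)) →
    ∀ x ∈ U, IsEigen (F x) (S.bracketRe T x) (S.bracketIm T x) (S.bracketForm T x)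

end CRF

end CRSub

/-! Write `D = TN ∩ J(TN)` and `R = TN ∩ J(νN)`. These are orthogonal, and `R = ker F`. A vector in
the `i`-eigenbundle is `FX + iX` with `X ∈ D`, and a form `β` in it satisfies `β ∘ F = -iβ`. Hence
`β` kills `R` and every `FX + iX`, the pairings in the Courant bracket vanish, and the `½ d` term
drops out.

The vector part of the bracket stays in the eigenbundle for every CR-submanifold of a complex
manifold (`inducedF_bracket`, from the vanishing Nijenhuis tensor). For the form part, consider `L_V
β` with `V = FX + iX`. On `D` it behaves well by the same integrability. For `Z` a section of `R`,
since `i` acts on `β` as precomposition with `-F`, its value is `-β([FX,Z] - F[X,Z])`. There are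
enough forms `β` to detect exactly the part of a vector outside `ker F`, so the CRF condition
amounts to `F[FX,Z] = F²[X,Z]` for all `X` in `D` and `Z` in `R` (`lieDeriv_isEigen`,
`IsClassicalCRF.inducedF_bracket`).

This is then expressed by the Levi-Civita connection (`inner_bracket_sub`): for `X, Y ∈ D`,
`γ([FX,Z] - F[X,Z], Y) = -γ(b(FX,FY) - b(X,Y), JZ) - γ((∇_Z J)X, Y)`. The first term on the right is
symmetric in `X, Y`, the second is skew, so the left side vanishes for all `X, Y` iff both terms do.
Finally `∇_{Jv} J = J ∇_v J` on a Hermitian manifold (`nablaJ_J_left`), whence `dΩ(X,Y,Z) -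
dΩ(JX,JY,Z) = 2γ((∇_Z J)X, Y)` (`extDerivTwo_kahlerForm_sub`), which turns the skew term into the
condition on `dΩ`. -/

namespace CRSub

/-! ### Lie brackets as commutators of derivations. -/

section Commutator

variable {E : Type*} [NormedAddCommGroup E] [NormedSpace ℝ E]
  {M : Type*} [TopologicalSpace M] [ChartedSpace E M] [IsManifold 𝓘(ℝ, E) ∞ M]
  {G : Type*} [NormedAddCommGroup G] [NormedSpace ℝ G]

theorem two_le_infty : (2 : WithTop ℕ∞) ≤ ∞ := WithTop.coe_le_coe.2 le_top

theorem range_modelWithCornersSelf : Set.range 𝓘(ℝ, E) = Set.univ := by simp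

/-- The derivative of a vector valued function read in the chart at `x`. -/
theorem mvfderiv_eq_fderiv_chart {f : M → G} {x z : M}
    (hz : z ∈ (extChartAt 𝓘(ℝ, E) x).source) (hf : MDiffAt f z) (v : TangentSpace 𝓘(ℝ, E) z) :
    mvfderiv 𝓘(ℝ, E) f z v =
      fderiv ℝ (f ∘ (extChartAt 𝓘(ℝ, E) x).symm) (extChartAt 𝓘(ℝ, E) x z)
        (mfderiv 𝓘(ℝ, E) 𝓘(ℝ, E) (extChartAt 𝓘(ℝ, E) x) z v) := by
  set φ := extChartAt 𝓘(ℝ, E) x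
  have hφ : MDifferentiableAt 𝓘(ℝ, E) 𝓘(ℝ, E) φ z :=
    mdifferentiableAt_extChartAt (by simpa [φ] using hz)
  have hsymm : MDifferentiableAt 𝓘(ℝ, E) 𝓘(ℝ, E) φ.symm (φ z) := by
    have := mdifferentiableWithinAt_extChartAt_symm (I := 𝓘(ℝ, E)) (x := x) (φ.map_source hz)
    rwa [range_modelWithCornersSelf, mdifferentiableWithinAt_univ] at this
  have h1 : MDifferentiableAt 𝓘(ℝ, E) 𝓘(ℝ, G) (f ∘ φ.symm) (φ z) :=
    MDifferentiableAt.comp (I' := 𝓘(ℝ, E)) (φ z) (by rwa [φ.left_inv hz]) hsymm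
  have heq : f =ᶠ[nhds z] (f ∘ φ.symm) ∘ φ := by
    filter_upwards [(isOpen_extChartAt_source (I := 𝓘(ℝ, E)) x).mem_nhds hz] with y hy
    simp [φ.left_inv hy]
  have h2 := mfderiv_comp (I' := 𝓘(ℝ, E)) z h1 hφ
  have h3 := heq.mfderiv_eq (I := 𝓘(ℝ, E)) (I' := 𝓘(ℝ, G))
  rw [← mfderiv_eq_fderiv]
  exact congrArg (fun T ↦ (show G from T v)) (h3.trans h2)

/-- The differentials of the chart and of its inverse are inverse to each other. The right-hand side
is the form in which `mlieBracket` sees the field. -/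
theorem mfderiv_extChartAt_eq_pullback {X : Π y : M, TangentSpace 𝓘(ℝ, E) y} {x z : M}
    (hz : z ∈ (extChartAt 𝓘(ℝ, E) x).source) :
    mfderiv 𝓘(ℝ, E) 𝓘(ℝ, E) (extChartAt 𝓘(ℝ, E) x) z (X z) =
      mpullbackWithin 𝓘(ℝ, E) 𝓘(ℝ, E) (extChartAt 𝓘(ℝ, E) x).symm X (Set.range 𝓘(ℝ, E))
        (extChartAt 𝓘(ℝ, E) x z) := by
  set φ := extChartAt 𝓘(ℝ, E) x
  rw [mpullbackWithin_apply]
  have h1 := mfderiv_extChartAt_comp_mfderivWithin_extChartAt_symm' (I := 𝓘(ℝ, E)) hz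
  have h2 := mfderivWithin_extChartAt_symm_comp_mfderiv_extChartAt' (I := 𝓘(ℝ, E)) hz
  have h3 := ContinuousLinearMap.inverse_eq h2 h1
  have h4 : φ.symm (φ z) = z := φ.left_inv hz
  refine (congrArg (fun T ↦ (show E from T (X z))) h3).symm.trans ?_
  change (_ : E →L[ℝ] E) _ = _
  exact congrArg (fun y ↦ (show E →L[ℝ] E from (mfderiv[Set.range 𝓘(ℝ, E)] φ.symm (φ z)).inverse)
    (show E from X y)) h4.symm

/-- A vector field read in the chart at `x`. -/
noncomputable def chartField (X : Π y : M, TangentSpace 𝓘(ℝ, E) y) (x : M) (e : E) : E :=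
  mpullbackWithin 𝓘(ℝ, E) 𝓘(ℝ, E) (extChartAt 𝓘(ℝ, E) x).symm X (Set.range 𝓘(ℝ, E)) e

variable [CompleteSpace E]

/-- The commutator of the derivations of vector valued functions along two vector fields. -/
theorem mvfderiv_mlieBracket {f : M → G} {x : M} (hf : ContMDiffAt 𝓘(ℝ, E) 𝓘(ℝ, G) ∞ f x)
    {X Y : Π y : M, TangentSpace 𝓘(ℝ, E) y} (hX : MDiffAt (T% X) x) (hY : MDiffAt (T% Y) x) :
    mvfderiv 𝓘(ℝ, E) f x (mlieBracket 𝓘(ℝ, E) X Y x) =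
      mvfderiv 𝓘(ℝ, E) (fun z ↦ mvfderiv 𝓘(ℝ, E) f z (Y z)) x (X x) -
      mvfderiv 𝓘(ℝ, E) (fun z ↦ mvfderiv 𝓘(ℝ, E) f z (X z)) x (Y x) := by
  set φ := extChartAt 𝓘(ℝ, E) x with hφ
  have hx : x ∈ φ.source := mem_extChartAt_source x
  set fc : E → G := f ∘ φ.symm
  have hfc : ContDiffAt ℝ ∞ fc (φ x) := by
    have := (contMDiffAt_iff (x := x) (f := f)).1 hf
    have h := this.2
    rwa [range_modelWithCornersSelf, contDiffWithinAt_univ] at h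
  have hdiff : ∀ {X : Π y : M, TangentSpace 𝓘(ℝ, E) y}, MDiffAt (T% X) x →
      DifferentiableAt ℝ (chartField X x) (φ x) := by
    intro X hX
    have := MDifferentiableWithinAt.differentiableWithinAt_mpullbackWithin_vectorField
      (I := 𝓘(ℝ, E)) (V := X) (s := Set.univ) (x := x) (mdifferentiableWithinAt_univ.2 hX)
    have h2 : DifferentiableWithinAt ℝ (chartField X x) Set.univ (φ x) := by
      convert! this using 1
      simp
    exact differentiableWithinAt_univ.1 h2
  -- An iterated derivation read in the chart is an iterated Fréchet derivative, which reduces the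
  -- claim to the commutator formula in a vector space.
  have key : ∀ {X Y : Π y : M, TangentSpace 𝓘(ℝ, E) y}, MDiffAt (T% Y) x →
      mvfderiv 𝓘(ℝ, E) (fun z ↦ mvfderiv 𝓘(ℝ, E) f z (Y z)) x (X x) =
        fderiv ℝ (fun e ↦ fderiv ℝ fc e (chartField Y x e)) (φ x) (chartField X x (φ x)) := by
    intro X Y hY
    have hf1 : ContMDiffAt 𝓘(ℝ, E) 𝓘(ℝ, G) 1 f x := hf.of_le (by simp)
    have hev : (fun z ↦ mvfderiv 𝓘(ℝ, E) f z (Y z)) =ᶠ[nhds x]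
        (fun e ↦ fderiv ℝ fc e (chartField Y x e)) ∘ φ := by
      filter_upwards [(isOpen_extChartAt_source (I := 𝓘(ℝ, E)) x).mem_nhds hx,
        ((contMDiffAt_iff_contMDiffAt_nhds (by simp)).1 hf1)] with z hz hfz
      rw [mvfderiv_eq_fderiv_chart hz (hfz.mdifferentiableAt (by simp)),
        mfderiv_extChartAt_eq_pullback hz]
      rfl
    have hd : DifferentiableAt ℝ (fun e ↦ fderiv ℝ fc e (chartField Y x e)) (φ x) :=
      ((hfc.fderiv_right (m := 1) two_le_infty).differentiableAt (by simp)).clm_apply (hdiff hY)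
    have h1 := mfderiv_comp (I' := 𝓘(ℝ, E)) x hd.mdifferentiableAt
      (mdifferentiableAt_extChartAt (I := 𝓘(ℝ, E)) (mem_chart_source E x))
    have h2 := hev.mfderiv_eq (I := 𝓘(ℝ, E)) (I' := 𝓘(ℝ, G))
    rw [mfderiv_eq_fderiv] at h1
    have h3 := congrArg (fun T ↦ (show G from T (X x))) (h2.trans h1)
    refine h3.trans ?_
    exact congrArg _ (mfderiv_extChartAt_eq_pullback hx)
  rw [key hY, key hX, ← fderiv_apply_lieBracket (n := 2) (hfc.of_le two_le_infty) (by simp)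
      (hdiff hY) (hdiff hX),
    mvfderiv_eq_fderiv_chart hx (hf.mdifferentiableAt (by simp))]
  refine congrArg (fderiv ℝ fc (φ x)) ?_
  -- `mlieBracket` is the inverse differential of the chart applied to the bracket in the chart, so
  -- applying the differential gives that bracket back.
  let w₀ : E := lieBracket ℝ (chartField X x) (chartField Y x) (φ x)
  let w : TangentSpace 𝓘(ℝ, E) (φ x) := w₀
  have h1 := (isInvertible_mfderiv_extChartAt (I := 𝓘(ℝ, E)) hx).self_apply_inverse
    (y := w)
  have h2 : lieBracketWithin ℝ (chartField X x) (chartField Y x)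
      (φ.symm ⁻¹' Set.univ ∩ Set.range 𝓘(ℝ, E)) (φ x) = w₀ := by
    rw [range_modelWithCornersSelf, Set.preimage_univ, Set.univ_inter, lieBracketWithin_univ]
  change _ = (show E from w)
  rw [← h1]
  exact congrArg (fun u : E ↦ (show E →L[ℝ] E from mfderiv 𝓘(ℝ, E) 𝓘(ℝ, E) φ x)
    ((show E →L[ℝ] E from (mfderiv 𝓘(ℝ, E) 𝓘(ℝ, E) φ x).inverse) u)) h2

end Commutator
-- The tensor `∇J` and the exterior derivative of the Kähler form.
section LeviCivita

variable {E : Type*} [NormedAddCommGroup E] [NormedSpace ℝ E] [FiniteDimensional ℝ E]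
  {M : Type*} [TopologicalSpace M] [ChartedSpace E M] [IsManifold 𝓘(ℝ, E) ∞ M]
  [RiemannianBundle (fun y : M ↦ TangentSpace 𝓘(ℝ, E) y)]
  [IsContMDiffRiemannianBundle 𝓘(ℝ, E) ∞ E (fun y : M ↦ TangentSpace 𝓘(ℝ, E) y)]
  {J : Π y : M, TangentSpace 𝓘(ℝ, E) y →L[ℝ] TangentSpace 𝓘(ℝ, E) y}
  {p : M} {X Y Z : Π y : M, TangentSpace 𝓘(ℝ, E) y} {f : M → ℝ}

theorem leviCivita_metric (hY : MDiffAt (T% Y) p) (hZ : MDiffAt (T% Z) p)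
    (v : TangentSpace 𝓘(ℝ, E) p) :
    mvfderiv 𝓘(ℝ, E) (fun y ↦ inner ℝ (Y y) (Z y)) p v =
      inner ℝ (leviCivita E M Y p v) (Z p) + inner ℝ (Y p) (leviCivita E M Z p v) := by
  have h := (leviCivita_spec E M).1.mvfderiv_inner_eq (extend E v) hY hZ
  simpa only [extend_apply_self] using h

theorem leviCivita_torsion (hX : MDiffAt (T% X) p) (hY : MDiffAt (T% Y) p) :
    leviCivita E M Y p (X p) - leviCivita E M X p (Y p) = mlieBracket 𝓘(ℝ, E) X Y p :=
  haveI : CompleteSpace E := FiniteDimensional.complete ℝ E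
  (CovariantDerivative.torsion_eq_zero_iff _).1 (leviCivita_spec E M).2 hX hY

theorem leviCivita_add (hX : MDiffAt (T% X) p) (hY : MDiffAt (T% Y) p) :
    leviCivita E M (X + Y) p = leviCivita E M X p + leviCivita E M Y p :=
  (leviCivita E M).isCovariantDerivativeOn.add hX hY (Set.mem_univ p)

theorem leviCivita_smul (hf : MDiffAt f p) (hX : MDiffAt (T% X) p)
    (v : TangentSpace 𝓘(ℝ, E) p) :
    leviCivita E M (f • X) p v = f p • leviCivita E M X p v + mvfderiv 𝓘(ℝ, E) f p v • X p := by
  rw [(leviCivita E M).isCovariantDerivativeOn.leibniz hX hf (Set.mem_univ p)]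
  rfl

theorem leviCivita_neg (hX : MDiffAt (T% X) p) :
    leviCivita E M (-X) p = -leviCivita E M X p := by
  have h := leviCivita_smul (f := fun _ ↦ (-1 : ℝ)) (mdifferentiableAt_const) hX
  ext v
  have h2 : (fun _ : M ↦ (-1 : ℝ)) • X = -X := by ext y; simp
  rw [← h2, h, mvfderiv_const]
  simp

variable (J) in
/-- The covariant derivative `(∇_v J) w` of an almost complex structure. -/
noncomputable def nablaJ (p : M) (v w : TangentSpace 𝓘(ℝ, E) p) : TangentSpace 𝓘(ℝ, E) p :=
  leviCivita E M (fun z ↦ J z (extend E w z)) p v - J p (leviCivita E M (extend E w) p v)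

variable (hJ : IsHermitianStructure J)
include hJ

omit [IsContMDiffRiemannianBundle 𝓘(ℝ, E) ∞ E (fun y : M ↦ TangentSpace 𝓘(ℝ, E) y)]
  [FiniteDimensional ℝ E] in
theorem IsHermitianStructure.mdiffAt (hX : MDiffAt (T% X) p) :
    MDiffAt (T% (fun z ↦ J z (X z))) p :=
  MDifferentiableAt.clm_bundle_apply (b := fun y : M ↦ y)
    ((hJ.contMDiff p).mdifferentiableAt (by simp)) hX

/-- The right-hand side is tensorial in `Y`, so the extension used to define `nablaJ` is immaterial.
-/
theorem nablaJ_eq (hY : MDiffAt (T% Y) p) (v : TangentSpace 𝓘(ℝ, E) p) :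
    nablaJ J p v (Y p) =
      leviCivita E M (fun z ↦ J z (Y z)) p v - J p (leviCivita E M Y p v) := by
  have ht : TensorialAt 𝓘(ℝ, E) E (fun Y : Π y : M, TangentSpace 𝓘(ℝ, E) y ↦
      leviCivita E M (fun z ↦ J z (Y z)) p v - J p (leviCivita E M Y p v)) p := by
    refine ⟨fun {f σ} hf hσ ↦ ?_, fun {σ τ} hσ hτ ↦ ?_⟩
    · have h1 : (fun z ↦ J z ((f • σ) z)) = f • (fun z ↦ J z (σ z)) := by
        ext z; simp
      rw [h1, leviCivita_smul hf (hJ.mdiffAt hσ), leviCivita_smul hf hσ]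
      simp only [map_add, map_smul]
      module
    · have h1 : (fun z ↦ J z ((σ + τ) z)) = (fun z ↦ J z (σ z)) + (fun z ↦ J z (τ z)) := by
        ext z; simp
      rw [h1, leviCivita_add (hJ.mdiffAt hσ) (hJ.mdiffAt hτ), leviCivita_add hσ hτ]
      simp only [add_apply, map_add]
      abel
  exact ht.pointwise (mdifferentiableAt_extend ..) hY (by simp)

theorem leviCivita_J (hY : MDiffAt (T% Y) p) (v : TangentSpace 𝓘(ℝ, E) p) :
    leviCivita E M (fun z ↦ J z (Y z)) p v = nablaJ J p v (Y p) + J p (leviCivita E M Y p v) := by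
  rw [nablaJ_eq hJ hY]; abel

omit [IsContMDiffRiemannianBundle 𝓘(ℝ, E) ∞ E (fun y : M ↦ TangentSpace 𝓘(ℝ, E) y)]
  [FiniteDimensional ℝ E] in
theorem IsHermitianStructure.inner_left (u v : TangentSpace 𝓘(ℝ, E) p) :
    inner ℝ (J p u) v = -inner ℝ u (J p v) := by
  have := hJ.inner_map_map p u (J p v)
  rw [hJ.sq_eq_neg, inner_neg_right] at this
  linarith

/-- Obtained by differentiating `J² = -1`. -/
theorem nablaJ_J (v w : TangentSpace 𝓘(ℝ, E) p) :
    nablaJ J p v (J p w) = -J p (nablaJ J p v w) := by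
  have hw : MDiffAt (T% (extend E w)) p := mdifferentiableAt_extend ..
  have h := nablaJ_eq hJ (hJ.mdiffAt hw) v
  have h2 : (fun z ↦ J z (J z (extend E w z))) = -extend E w := by
    ext z; simp [hJ.sq_eq_neg]
  rw [h2, leviCivita_neg hw, leviCivita_J hJ hw, map_add, hJ.sq_eq_neg] at h
  simp only [extend_apply_self, neg_apply] at h
  rw [h]; abel

/-- Obtained by differentiating the skew-symmetry of `J`. -/
theorem inner_nablaJ (v w u : TangentSpace 𝓘(ℝ, E) p) :
    inner ℝ (nablaJ J p v w) u = -inner ℝ w (nablaJ J p v u) := by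
  have hw : MDiffAt (T% (extend E w)) p := mdifferentiableAt_extend ..
  have hu : MDiffAt (T% (extend E u)) p := mdifferentiableAt_extend ..
  have h1 := leviCivita_metric (hJ.mdiffAt hw) hu v
  have h2 := leviCivita_metric hw (hJ.mdiffAt hu) v
  have h3 : (fun y ↦ inner ℝ (J y (extend E w y)) (extend E u y)) =
      -fun y ↦ inner ℝ (extend E w y) (J y (extend E u y)) := by
    ext y; simp [hJ.inner_left]
  rw [h3, mvfderiv_neg, neg_apply, h2] at h1
  rw [leviCivita_J hJ hw, leviCivita_J hJ hu] at h1
  simp only [extend_apply_self, inner_add_left, inner_add_right, hJ.inner_left] at h1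
  linarith

/-- On a Hermitian manifold `∇_{Jv} J = J ∘ ∇_v J`. -/
theorem nablaJ_J_left (v w : TangentSpace 𝓘(ℝ, E) p) :
    nablaJ J p (J p v) w = J p (nablaJ J p v w) := by
  -- The Nijenhuis tensor equals `S v w - S w v`, so `S` is symmetric, while each `S v` is skew for
  -- the metric. A function of three vectors that is symmetric in the first two slots and skew in
  -- the last two vanishes, as in the uniqueness of the Levi-Civita connection.
  set S : TangentSpace 𝓘(ℝ, E) p → TangentSpace 𝓘(ℝ, E) p → TangentSpace 𝓘(ℝ, E) p :=
    fun v w ↦ nablaJ J p (J p v) w - J p (nablaJ J p v w) with hS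
  have hsymm : ∀ v w, S v w = S w v := by
    intro v w
    have hv : MDiffAt (T% (extend E v)) p := mdifferentiableAt_extend ..
    have hw : MDiffAt (T% (extend E w)) p := mdifferentiableAt_extend ..
    have h := hJ.nijenhuis_eq_zero (extend E v) (extend E w) p (contMDiffAt_extend ..)
      (contMDiffAt_extend ..)
    rw [← leviCivita_torsion (hJ.mdiffAt hv) (hJ.mdiffAt hw),
      ← leviCivita_torsion (hJ.mdiffAt hv) hw, ← leviCivita_torsion hv (hJ.mdiffAt hw),
      ← leviCivita_torsion hv hw, leviCivita_J hJ hv, leviCivita_J hJ hw, leviCivita_J hJ hv,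
      leviCivita_J hJ hw] at h
    simp only [extend_apply_self, map_sub, map_add, hJ.sq_eq_neg] at h
    simp only [hS]
    rw [← sub_eq_zero, ← h]
    abel
  have hanti : ∀ v w u, inner ℝ (S v w) u = -inner ℝ w (S v u) := by
    intro v w u
    simp only [hS, inner_sub_left, inner_sub_right]
    rw [inner_nablaJ hJ, hJ.inner_left, inner_nablaJ hJ, nablaJ_J hJ, inner_neg_right]
    ring
  have hzero : ∀ v w u, inner ℝ (S v w) u = 0 := by
    intro v w u
    have e1 : ∀ a b c, inner ℝ (S a b) c = -inner ℝ (S a c) b := fun a b c ↦ by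
      rw [hanti, real_inner_comm]
    have e2 : ∀ a b c, inner ℝ (S a b) c = inner ℝ (S b a) c := fun a b c ↦ by rw [hsymm]
    linarith [e1 v w u, e2 v u w, e1 u v w, e2 u w v, e1 w u v, e2 w v u]
  exact sub_eq_zero.1 (ext_inner_right ℝ fun u ↦ by simpa using hzero v w u)

/-- Metric compatibility expands the derivatives and zero torsion the brackets; all terms in which
`J` is not differentiated cancel. -/
theorem extDerivTwo_kahlerForm (u v w : TangentSpace 𝓘(ℝ, E) p) :
    extDerivTwo (kahlerForm J) p u v w = inner ℝ (nablaJ J p u v) w +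
      inner ℝ (nablaJ J p v w) u + inner ℝ (nablaJ J p w u) v := by
  have hu : MDiffAt (T% (extend E u)) p := mdifferentiableAt_extend ..
  have hv : MDiffAt (T% (extend E v)) p := mdifferentiableAt_extend ..
  have hw : MDiffAt (T% (extend E w)) p := mdifferentiableAt_extend ..
  simp only [extDerivTwo, cartanTwo, kahlerForm]
  rw [leviCivita_metric (hJ.mdiffAt hu) hv, leviCivita_metric (hJ.mdiffAt hu) hw,
    leviCivita_metric (hJ.mdiffAt hv) hw, ← leviCivita_torsion hu hv, ← leviCivita_torsion hu hw,
    ← leviCivita_torsion hv hw, leviCivita_J hJ hu, leviCivita_J hJ hv, leviCivita_J hJ hu]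
  simp only [extend_apply_self, map_sub, inner_add_left, inner_sub_left]
  have h1 : inner ℝ (nablaJ J p v u) w = -inner ℝ (nablaJ J p v w) u := by
    rw [inner_nablaJ hJ, real_inner_comm]
  have c : ∀ a b : TangentSpace 𝓘(ℝ, E) p, inner ℝ (J p a) b = -inner ℝ (J p b) a := fun a b ↦ by
    rw [hJ.inner_left, real_inner_comm]
  rw [c (leviCivita E M (extend E v) p u) w, c (leviCivita E M (extend E u) p v) w]
  rw [c (leviCivita E M (extend E w) p u) v, c (leviCivita E M (extend E u) p w) v]
  rw [c (leviCivita E M (extend E w) p v) u, c (leviCivita E M (extend E v) p w) u]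
  linarith

/-- Passing from `(u, v)` to `(Ju, Jv)` preserves two of the three cyclic terms and changes the sign
of the one differentiated along `w`. -/
theorem extDerivTwo_kahlerForm_sub (u v w : TangentSpace 𝓘(ℝ, E) p) :
    extDerivTwo (kahlerForm J) p u v w - extDerivTwo (kahlerForm J) p (J p u) (J p v) w =
      2 * inner ℝ (nablaJ J p w u) v := by
  simp only [extDerivTwo_kahlerForm hJ, nablaJ_J_left hJ, nablaJ_J hJ, map_neg, hJ.sq_eq_neg,
    hJ.inner_map_map, inner_neg_left, neg_neg]
  ring

end LeviCivita
-- Derivatives of vector-valued functions.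
section VectorValued

variable {E : Type*} [NormedAddCommGroup E] [NormedSpace ℝ E]
  {M : Type*} [TopologicalSpace M] [ChartedSpace E M]
  {E' : Type*} [NormedAddCommGroup E'] [NormedSpace ℝ E']
  {N : Type*} [TopologicalSpace N] [ChartedSpace E' N]
  {G : Type*} [NormedAddCommGroup G] [NormedSpace ℝ G]

theorem mvfderiv_congr {f g : M → G} {x : M} (h : f =ᶠ[nhds x] g) :
    mvfderiv 𝓘(ℝ, E) f x = mvfderiv 𝓘(ℝ, E) g x := by
  ext v
  exact congrArg (fun T ↦ (show G from T v)) (h.mfderiv_eq (I := 𝓘(ℝ, E)) (I' := 𝓘(ℝ, G)))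

theorem mvfderiv_comp_mfderiv {f : M → G} {ι : N → M} {x : N} (hf : MDiffAt f (ι x))
    (hι : MDifferentiableAt 𝓘(ℝ, E') 𝓘(ℝ, E) ι x) (v : TangentSpace 𝓘(ℝ, E') x) :
    mvfderiv 𝓘(ℝ, E') (fun z ↦ f (ι z)) x v =
      mvfderiv 𝓘(ℝ, E) f (ι x) (mfderiv 𝓘(ℝ, E') 𝓘(ℝ, E) ι x v) :=
  congrArg (fun T ↦ (show G from T v)) (mfderiv_comp (I' := 𝓘(ℝ, E)) x hf hι)

theorem mvfderiv_clm_comp {G' : Type*} [NormedAddCommGroup G'] [NormedSpace ℝ G'] (L : G →L[ℝ] G')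
    {f : M → G} {x : M} (hf : MDiffAt f x) (v : TangentSpace 𝓘(ℝ, E) x) :
    mvfderiv 𝓘(ℝ, E) (fun z ↦ L (f z)) x v = L (mvfderiv 𝓘(ℝ, E) f x v) := by
  have := mfderiv_comp (I' := 𝓘(ℝ, G)) (I'' := 𝓘(ℝ, G')) x
    (L.differentiableAt (x := f x)).mdifferentiableAt hf
  rw [mfderiv_eq_fderiv, L.fderiv] at this
  exact congrArg (fun T ↦ (show G' from T v)) this

end VectorValued

/-! ### Coordinates on the tangent bundle. -/

section Coordinates

variable {E : Type*} [NormedAddCommGroup E] [NormedSpace ℝ E] [FiniteDimensional ℝ E]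
  {M : Type*} [TopologicalSpace M] [ChartedSpace E M] [IsManifold 𝓘(ℝ, E) ∞ M]

/-- The coordinates of a tangent vector in the preferred trivialization at `p`. -/
noncomputable def coord (p : M) (y : M) (v : TangentSpace 𝓘(ℝ, E) y) : E :=
  (trivializationAt E (TangentSpace 𝓘(ℝ, E)) p (TotalSpace.mk' E y v)).2

omit [FiniteDimensional ℝ E] in
theorem coord_eq_clm {p y : M} (hy : y ∈ (chartAt E p).source) (v : TangentSpace 𝓘(ℝ, E) y) :
    coord p y v =
      (trivializationAt E (TangentSpace 𝓘(ℝ, E)) p).continuousLinearMapAt ℝ y v := by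
  have h : y ∈ (trivializationAt E (TangentSpace 𝓘(ℝ, E)) p).baseSet := hy
  rw [Trivialization.continuousLinearMapAt_apply, Trivialization.linearMapAt_apply, if_pos h]
  rfl

omit [FiniteDimensional ℝ E] in
theorem symmL_coord (p : M) (v : TangentSpace 𝓘(ℝ, E) p) :
    (trivializationAt E (TangentSpace 𝓘(ℝ, E)) p).symmL ℝ p (coord p p v) = v := by
  rw [coord_eq_clm (mem_chart_source E p)]
  exact Trivialization.symmL_continuousLinearMapAt _ (mem_chart_source E p) v

omit [FiniteDimensional ℝ E] in
-- Coordinates of tangent vectors are derivatives of the chart, so the commutator formula for the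
-- vector-valued function `extChartAt` computes coordinates of brackets.
theorem coord_eq_mvfderiv {p y : M} (hy : y ∈ (chartAt E p).source)
    (v : TangentSpace 𝓘(ℝ, E) y) :
    coord p y v = mvfderiv 𝓘(ℝ, E) (extChartAt 𝓘(ℝ, E) p) y v := by
  rw [coord_eq_clm hy, TangentBundle.continuousLinearMapAt_trivializationAt hy]
  rfl

omit [FiniteDimensional ℝ E] in
theorem coord_extend {p y : M} (hy : y ∈ (chartAt E p).source) (v : TangentSpace 𝓘(ℝ, E) p) :
    coord p y (extend E v y) = coord p p v := by
  have h : y ∈ (trivializationAt E (TangentSpace 𝓘(ℝ, E)) p).baseSet := hy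
  have h2 := congrArg Prod.snd (Trivialization.apply_mk_symm _ h (coord p p v))
  exact h2

omit [FiniteDimensional ℝ E] in
/-- The coordinate vector fields at a point commute. -/
theorem mlieBracket_extend [CompleteSpace E] (p : M) (u v : TangentSpace 𝓘(ℝ, E) p) :
    mlieBracket 𝓘(ℝ, E) (extend E u) (extend E v) p = 0 := by
  have h := mvfderiv_mlieBracket (f := extChartAt 𝓘(ℝ, E) p) (x := p) contMDiffAt_extChartAt
    (mdifferentiableAt_extend 𝓘(ℝ, E) E u) (mdifferentiableAt_extend 𝓘(ℝ, E) E v)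
  -- The derivative of the chart along a coordinate field is constant, so both iterated derivatives
  -- vanish.
  have key : ∀ w : TangentSpace 𝓘(ℝ, E) p, mvfderiv 𝓘(ℝ, E)
      (fun z ↦ mvfderiv 𝓘(ℝ, E) (extChartAt 𝓘(ℝ, E) p) z (extend E w z)) p = 0 := by
    intro w
    rw [← mvfderiv_const (I := 𝓘(ℝ, E)) (coord p p w) (x := p)]
    refine mvfderiv_congr ?_
    filter_upwards [chart_source_mem_nhds E p] with z hz
    rw [← coord_eq_mvfderiv hz, coord_extend hz]
  rw [key, key, ← coord_eq_mvfderiv (mem_chart_source E p)] at h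
  rw [← symmL_coord p (mlieBracket _ _ _ p), h]
  simp

variable [RiemannianBundle (fun y : M ↦ TangentSpace 𝓘(ℝ, E) y)]
  [IsContMDiffRiemannianBundle 𝓘(ℝ, E) ∞ E (fun y : M ↦ TangentSpace 𝓘(ℝ, E) y)]

omit [FiniteDimensional ℝ E] [RiemannianBundle (fun y : M ↦ TangentSpace 𝓘(ℝ, E) y)]
  [IsContMDiffRiemannianBundle 𝓘(ℝ, E) ∞ E (fun y : M ↦ TangentSpace 𝓘(ℝ, E) y)] in
theorem mdiffAt_coord {p : M} {X : Π y : M, TangentSpace 𝓘(ℝ, E) y} (hX : MDiffAt (T% X) p) :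
    MDiffAt (fun z ↦ coord p z (X z)) p :=
  (mdifferentiableAt_section 𝓘(ℝ, E) X).1 hX

/-- The Levi-Civita connection in coordinates. -/
theorem leviCivita_eq_coord {p : M} {X : Π y : M, TangentSpace 𝓘(ℝ, E) y}
    (hX : MDiffAt (T% X) p) (v : TangentSpace 𝓘(ℝ, E) p) :
    leviCivita E M X p v = (trivializationAt E (TangentSpace 𝓘(ℝ, E)) p).symmL ℝ p
      (mvfderiv 𝓘(ℝ, E) (fun z ↦ coord p z (X z)) p v) + leviCivita E M (extend E (X p)) p v := by
  set L := (trivializationAt E (TangentSpace 𝓘(ℝ, E)) p).symmL ℝ p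
  -- By tensoriality `X` may be replaced by `extend E (X p)`, whose coordinates are constant, so
  -- that the derivative term disappears.
  have ht : TensorialAt 𝓘(ℝ, E) E (fun X : Π y : M, TangentSpace 𝓘(ℝ, E) y ↦
      leviCivita E M X p v - L (mvfderiv 𝓘(ℝ, E) (fun z ↦ coord p z (X z)) p v)) p := by
    refine ⟨fun {f σ} hf hσ ↦ ?_, fun {σ τ} hσ hτ ↦ ?_⟩
    · have h1 : (fun z ↦ coord p z ((f • σ) z)) =ᶠ[nhds p] f • fun z ↦ coord p z (σ z) := by
        filter_upwards [chart_source_mem_nhds E p] with z hz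
        simp [coord_eq_clm hz]
      rw [mvfderiv_congr h1, mvfderiv_smul hf (mdiffAt_coord hσ), leviCivita_smul hf hσ]
      simp only [add_apply, smul_apply, ContinuousLinearMap.smulRight_apply, map_add, map_smul, L,
        symmL_coord]
      module
    · have h1 : (fun z ↦ coord p z ((σ + τ) z)) =ᶠ[nhds p]
          (fun z ↦ coord p z (σ z)) + fun z ↦ coord p z (τ z) := by
        filter_upwards [chart_source_mem_nhds E p] with z hz
        simp [coord_eq_clm hz]
      rw [mvfderiv_congr h1, mvfderiv_add (mdiffAt_coord hσ) (mdiffAt_coord hτ),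
        leviCivita_add hσ hτ]
      simp only [add_apply, map_add]
      abel
  have h := ht.pointwise hX (mdifferentiableAt_extend 𝓘(ℝ, E) E (X p)) (by simp)
  have h2 : (fun z ↦ coord p z (extend E (X p) z)) =ᶠ[nhds p] fun _ ↦ coord p p (X p) := by
    filter_upwards [chart_source_mem_nhds E p] with z hz
    rw [coord_extend hz]
  rw [mvfderiv_congr h2, mvfderiv_const] at h
  simp only [zero_apply, map_zero, sub_zero] at h
  rw [← h]; abel

end Coordinates
-- Vector fields along an immersion.
section Along

set_option linter.unusedSectionVars false

variable {E : Type*} [NormedAddCommGroup E] [NormedSpace ℝ E]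
  {M : Type*} [TopologicalSpace M] [ChartedSpace E M] [IsManifold 𝓘(ℝ, E) ∞ M]
  {E' : Type*} [NormedAddCommGroup E'] [NormedSpace ℝ E']
  {N : Type*} [TopologicalSpace N] [ChartedSpace E' N] [IsManifold 𝓘(ℝ, E') ∞ N]
  {ι : N → M} {x : N}

/-- An immersion has differentiable local left inverses. -/
theorem exists_local_leftInverse (hι : Manifold.IsImmersion 𝓘(ℝ, E') 𝓘(ℝ, E) ∞ ι) (x : N) :
    ∃ G : M → N, MDifferentiableAt 𝓘(ℝ, E) 𝓘(ℝ, E') G (ι x) ∧ ∀ᶠ z in nhds x, G (ι z) = z := by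
  have h := hι.isImmersionAt x
  set φ := h.domChart.extend 𝓘(ℝ, E') with hφ
  set ψ := h.codChart.extend 𝓘(ℝ, E) with hψ
  have hψm : MDifferentiableAt 𝓘(ℝ, E) 𝓘(ℝ, E) ψ (ι x) :=
    (h.codChart.contMDiffAt_extend h.codChart_mem_maximalAtlas
      h.mem_codChart_source).mdifferentiableAt (by simp)
  have hs : φ.source ∈ nhds x := by
    rw [hφ, OpenPartialHomeomorph.extend_source]
    exact h.domChart.open_source.mem_nhds h.mem_domChart_source
  have hsrc : x ∈ φ.source := mem_of_mem_nhds hs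
  have hopen : φ.target ∈ nhds (φ x) := by
    have : IsOpen φ.target := by simpa [hφ] using h.domChart.open_target
    exact this.mem_nhds (φ.map_source hsrc)
  have hsm : MDifferentiableAt 𝓘(ℝ, E') 𝓘(ℝ, E') φ.symm (φ x) :=
    ((contMDiffOn_extend_symm h.domChart_mem_maximalAtlas).contMDiffAt
      (by simpa [hφ] using hopen)).mdifferentiableAt (by simp)
  -- In charts adapted to the immersion `ι` is `e ↦ h.equiv (e, 0)`, so the first component of
  -- `h.equiv.symm` undoes it.
  let L : E → E' := fun e ↦ (h.equiv.symm e).1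
  have hL : MDifferentiableAt 𝓘(ℝ, E) 𝓘(ℝ, E') L (ψ (ι x)) := by
    have : Differentiable ℝ L := by fun_prop
    exact this.differentiableAt.mdifferentiableAt
  have hLz : ∀ z ∈ φ.source, L (ψ (ι z)) = φ z := by
    intro z hz
    have := h.writtenInCharts (φ.map_source hz)
    simp only [Function.comp_apply] at this
    rw [φ.left_inv hz] at this
    have hψz : ψ (ι z) = h.equiv (φ z, 0) := this
    simp only [L, hψz, ContinuousLinearEquiv.symm_apply_apply]
  refine ⟨φ.symm ∘ L ∘ ψ, ?_, ?_⟩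
  · refine MDifferentiableAt.comp (I' := 𝓘(ℝ, E')) (ι x) ?_ (hL.comp (ι x) hψm)
    simpa [hLz x hsrc] using hsm
  · filter_upwards [hs] with z hz
    simp only [Function.comp_apply, hLz z hz, φ.left_inv hz]

/-- Differentiability at `x` of a vector field `W` of `M` along `ι`. -/
def MDiffAlong (ι : N → M) (W : Π z : N, TangentSpace 𝓘(ℝ, E) (ι z)) (x : N) : Prop :=
  MDifferentiableAt 𝓘(ℝ, E') (𝓘(ℝ, E).prod 𝓘(ℝ, E))
    (fun z ↦ (TotalSpace.mk' E (ι z) (W z) : TangentBundle 𝓘(ℝ, E) M)) x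

/-- A differentiable vector field along an immersion extends locally to a vector field of `M`. -/
theorem MDiffAlong.exists_extension (hι : Manifold.IsImmersion 𝓘(ℝ, E') 𝓘(ℝ, E) ∞ ι)
    {W : Π z : N, TangentSpace 𝓘(ℝ, E) (ι z)} (hW : MDiffAlong (E' := E') ι W x) :
    ∃ W' : Π y : M, TangentSpace 𝓘(ℝ, E) y, MDiffAt (T% W') (ι x) ∧
      ∀ᶠ z in nhds x, W' (ι z) = W z := by
  obtain ⟨G, hG, hGι⟩ := exists_local_leftInverse hι x
  let e := trivializationAt E (TangentSpace 𝓘(ℝ, E)) (ι x)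
  have hmem : ∀ y : M, y ∈ (chartAt E (ι x)).source ↔ y ∈ e.baseSet := fun y ↦ Iff.rfl
  have hW2 := ((mdifferentiableAt_totalSpace _ _).1 hW).2
  -- The extension has at `y` the coordinates that `W` has at `G y`.
  refine ⟨fun y ↦ e.symm y (coord (ι x) (ι (G y)) (W (G y))), ?_, ?_⟩
  · rw [mdifferentiableAt_section]
    have h1 : MDifferentiableAt 𝓘(ℝ, E) 𝓘(ℝ, E)
        ((fun z ↦ coord (ι x) (ι z) (W z)) ∘ G) (ι x) :=
      MDifferentiableAt.comp (I' := 𝓘(ℝ, E')) (ι x) (by rw [hGι.self_of_nhds]; exact hW2) hG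
    refine h1.congr_of_eventuallyEq ?_
    filter_upwards [chart_source_mem_nhds E (ι x)] with y hy
    have h2 := congrArg Prod.snd (Trivialization.apply_mk_symm e ((hmem y).1 hy)
      (coord (ι x) (ι (G y)) (W (G y))))
    exact h2
  · have hc : ∀ᶠ z in nhds x, ι z ∈ (chartAt E (ι x)).source :=
      hι.contMDiff.continuous.continuousAt (chart_source_mem_nhds E (ι x))
    filter_upwards [hGι, hc] with z hz hzs
    rw [hz]
    exact Trivialization.symm_apply_apply_mk _ ((hmem _).1 hzs) _

theorem MDiffAlong.comp (hι : ContMDiff 𝓘(ℝ, E') 𝓘(ℝ, E) ∞ ι)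
    {W : Π y : M, TangentSpace 𝓘(ℝ, E) y} (hW : MDiffAt (T% W) (ι x)) :
    MDiffAlong (E' := E') ι (fun z ↦ W (ι z)) x :=
  MDifferentiableAt.comp (I' := 𝓘(ℝ, E)) x hW ((hι x).mdifferentiableAt (by simp))

theorem mdiffAlong_mfderiv (hι : ContMDiff 𝓘(ℝ, E') 𝓘(ℝ, E) ∞ ι)
    {X : Π z : N, TangentSpace 𝓘(ℝ, E') z} (hX : MDiffAt (T% X) x) :
    MDiffAlong (E' := E') ι (fun z ↦ mfderiv 𝓘(ℝ, E') 𝓘(ℝ, E) ι z (X z)) x := by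
  have h := ((hι x).mfderiv_const (m := 1) two_le_infty).mdifferentiableAt (by simp)
  exact MDifferentiableAt.clm_apply_of_inCoordinates (b₁ := fun z : N ↦ z) (b₂ := ι)
    (ϕ := fun z ↦ mfderiv 𝓘(ℝ, E') 𝓘(ℝ, E) ι z) h hX ((hι x).mdifferentiableAt (by simp))

variable [FiniteDimensional ℝ E] [RiemannianBundle (fun y : M ↦ TangentSpace 𝓘(ℝ, E) y)]
  [IsContMDiffRiemannianBundle 𝓘(ℝ, E) ∞ E (fun y : M ↦ TangentSpace 𝓘(ℝ, E) y)]

/-- The covariant derivative along `ι` of the restriction of a vector field of `M`. -/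
theorem covAlong_eq_leviCivita (hι : ContMDiff 𝓘(ℝ, E') 𝓘(ℝ, E) ∞ ι)
    {W : Π z : N, TangentSpace 𝓘(ℝ, E) (ι z)} {W' : Π y : M, TangentSpace 𝓘(ℝ, E) y}
    (hW' : MDiffAt (T% W') (ι x)) (h : ∀ᶠ z in nhds x, W' (ι z) = W z)
    (u : TangentSpace 𝓘(ℝ, E') x) :
    covAlong ι W x u = leviCivita E M W' (ι x) (mfderiv 𝓘(ℝ, E') 𝓘(ℝ, E) ι x u) := by
  rw [leviCivita_eq_coord hW', covAlong, ← h.self_of_nhds]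
  congr 2
  rw [← mvfderiv_comp_mfderiv (mdiffAt_coord hW') ((hι x).mdifferentiableAt (by simp))]
  have h2 : (fun z ↦ coord (ι x) (ι z) (W' (ι z))) =ᶠ[nhds x]
      fun z ↦ coord (ι x) (ι z) (W z) := by
    filter_upwards [h] with z hz
    rw [hz]
  rw [mvfderiv_congr h2]
  rfl

/-- The connection along `ι` inherits zero torsion. The derivative terms form the commutator for the
chart composed with `ι`; the connection terms cancel, since `∇` is torsion-free and coordinate
fields commute. -/
theorem covAlong_mfderiv_sub [CompleteSpace E'] (hι : ContMDiff 𝓘(ℝ, E') 𝓘(ℝ, E) ∞ ι)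
    {X Y : Π z : N, TangentSpace 𝓘(ℝ, E') z} (hX : MDiffAt (T% X) x) (hY : MDiffAt (T% Y) x) :
    covAlong ι (fun z ↦ mfderiv 𝓘(ℝ, E') 𝓘(ℝ, E) ι z (Y z)) x (X x) -
      covAlong ι (fun z ↦ mfderiv 𝓘(ℝ, E') 𝓘(ℝ, E) ι z (X z)) x (Y x) =
      mfderiv 𝓘(ℝ, E') 𝓘(ℝ, E) ι x (mlieBracket 𝓘(ℝ, E') X Y x) := by
  have : CompleteSpace E := FiniteDimensional.complete ℝ E
  set f : N → E := fun z ↦ extChartAt 𝓘(ℝ, E) (ι x) (ι z)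
  have hf : ContMDiffAt 𝓘(ℝ, E') 𝓘(ℝ, E) ∞ f x :=
    (contMDiffAt_extChartAt (x := ι x)).comp x (hι x)
  have hev : ∀ Z : Π z : N, TangentSpace 𝓘(ℝ, E') z,
      (fun z ↦ coord (ι x) (ι z) (mfderiv 𝓘(ℝ, E') 𝓘(ℝ, E) ι z (Z z))) =ᶠ[nhds x]
        fun z ↦ mvfderiv 𝓘(ℝ, E') f z (Z z) := by
    intro Z
    have hc : ∀ᶠ z in nhds x, ι z ∈ (chartAt E (ι x)).source :=
      hι.continuous.continuousAt (chart_source_mem_nhds E (ι x))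
    filter_upwards [hc] with z hz
    rw [coord_eq_mvfderiv hz, ← mvfderiv_comp_mfderiv (mdifferentiableAt_extChartAt hz)
      ((hι z).mdifferentiableAt (by simp))]
  have htor := leviCivita_torsion
    (mdifferentiableAt_extend 𝓘(ℝ, E) E (mfderiv 𝓘(ℝ, E') 𝓘(ℝ, E) ι x (X x)))
    (mdifferentiableAt_extend 𝓘(ℝ, E) E (mfderiv 𝓘(ℝ, E') 𝓘(ℝ, E) ι x (Y x)))
  rw [mlieBracket_extend] at htor
  simp only [extend_apply_self] at htor
  have h := mvfderiv_mlieBracket hf hX hY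
  rw [← mvfderiv_congr (hev X), ← mvfderiv_congr (hev Y),
    ← show _ = mvfderiv 𝓘(ℝ, E') f x (mlieBracket 𝓘(ℝ, E') X Y x) from
      (hev (mlieBracket 𝓘(ℝ, E') X Y)).self_of_nhds] at h
  have h2 := congrArg ((trivializationAt E (TangentSpace 𝓘(ℝ, E)) (ι x)).symmL ℝ (ι x)) h
  rw [symmL_coord, map_sub] at h2
  rw [h2, covAlong, covAlong, add_sub_add_comm, htor, add_zero]
  rfl

end Along
-- Pointwise algebra of the induced F structure.
section InducedF

set_option linter.unusedSectionVars false

variable {E : Type*} [NormedAddCommGroup E] [NormedSpace ℝ E]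
  {M : Type*} [TopologicalSpace M] [ChartedSpace E M] [IsManifold 𝓘(ℝ, E) ∞ M]
  [RiemannianBundle (fun y : M ↦ TangentSpace 𝓘(ℝ, E) y)]
  {E' : Type*} [NormedAddCommGroup E'] [NormedSpace ℝ E'] [FiniteDimensional ℝ E']
  {N : Type*} [TopologicalSpace N] [ChartedSpace E' N] [IsManifold 𝓘(ℝ, E') ∞ N]
  {J : Π y : M, TangentSpace 𝓘(ℝ, E) y →L[ℝ] TangentSpace 𝓘(ℝ, E) y} {ι : N → M} {x : N}

theorem mem_normalSpace_iff {n : TangentSpace 𝓘(ℝ, E) (ι x)} :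
    n ∈ normalSpace E E' ι x ↔
      ∀ u : TangentSpace 𝓘(ℝ, E') x, inner ℝ (mfderiv 𝓘(ℝ, E') 𝓘(ℝ, E) ι x u) n = 0 := by
  rw [normalSpace, Submodule.mem_orthogonal]
  constructor
  · exact fun h u ↦ h _ ⟨u, rfl⟩
  · rintro h _ ⟨u, rfl⟩
    exact h u

variable (hJ : IsHermitianStructure J)
include hJ

theorem mem_holoDist_iff {v : TangentSpace 𝓘(ℝ, E') x} :
    v ∈ holoDist (E' := E') J ι x ↔ ∃ w : TangentSpace 𝓘(ℝ, E') x,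
      mfderiv 𝓘(ℝ, E') 𝓘(ℝ, E) ι x w = J (ι x) (mfderiv 𝓘(ℝ, E') 𝓘(ℝ, E) ι x v) := by
  constructor
  · rintro ⟨_, ⟨w, rfl⟩, hw⟩
    refine ⟨-w, ?_⟩
    simp only [ContinuousLinearMap.coe_coe] at hw
    rw [← hw, hJ.sq_eq_neg, map_neg]
  · rintro ⟨w, hw⟩
    refine ⟨_, ⟨-w, rfl⟩, ?_⟩
    simp only [ContinuousLinearMap.coe_coe, map_neg]
    rw [hw, hJ.sq_eq_neg, neg_neg]

theorem mem_realDist_iff {v : TangentSpace 𝓘(ℝ, E') x} :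
    v ∈ realDist (E' := E') J ι x ↔
      J (ι x) (mfderiv 𝓘(ℝ, E') 𝓘(ℝ, E) ι x v) ∈ normalSpace E E' ι x := by
  constructor
  · rintro ⟨n, hn, hv⟩
    simp only [ContinuousLinearMap.coe_coe] at hv
    rw [← hv, hJ.sq_eq_neg]
    exact neg_mem hn
  · intro h
    refine ⟨_, neg_mem h, ?_⟩
    simp only [ContinuousLinearMap.coe_coe, map_neg]
    rw [hJ.sq_eq_neg, neg_neg]

variable (hN : IsCRSubmanifold (E' := E') J ι)

theorem mfderiv_inducedF {v : TangentSpace 𝓘(ℝ, E') x} (hv : v ∈ holoDist (E' := E') J ι x) :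
    mfderiv 𝓘(ℝ, E') 𝓘(ℝ, E) ι x (inducedF hJ hN x v) =
      J (ι x) (mfderiv 𝓘(ℝ, E') 𝓘(ℝ, E) ι x v) :=
  (existsUnique_inducedF hJ hN x).choose_spec.1.1 v hv

theorem inducedF_of_mem_realDist {v : TangentSpace 𝓘(ℝ, E') x}
    (hv : v ∈ realDist (E' := E') J ι x) : inducedF hJ hN x v = 0 :=
  (existsUnique_inducedF hJ hN x).choose_spec.1.2 v hv

omit hJ in
include hN in
theorem IsCRSubmanifold.exists_add (v : TangentSpace 𝓘(ℝ, E') x) :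
    ∃ d ∈ holoDist (E' := E') J ι x, ∃ r ∈ realDist (E' := E') J ι x, d + r = v :=
  Submodule.mem_sup.1 ((hN.isCompl x).codisjoint.eq_top ▸ Submodule.mem_top)

omit hN in
-- The isometry `J` sends the first vector into `TN` and the second into `νN`.
theorem inner_holoDist_realDist {d r : TangentSpace 𝓘(ℝ, E') x}
    (hd : d ∈ holoDist (E' := E') J ι x) (hr : r ∈ realDist (E' := E') J ι x) :
    inner ℝ (mfderiv 𝓘(ℝ, E') 𝓘(ℝ, E) ι x d) (mfderiv 𝓘(ℝ, E') 𝓘(ℝ, E) ι x r) = 0 := by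
  obtain ⟨w, hw⟩ := (mem_holoDist_iff hJ).1 hd
  rw [← hJ.inner_map_map, ← hw]
  exact mem_normalSpace_iff.1 ((mem_realDist_iff hJ).1 hr) w

theorem inducedF_mem_of_mem {v : TangentSpace 𝓘(ℝ, E') x} (hv : v ∈ holoDist (E' := E') J ι x) :
    inducedF hJ hN x v ∈ holoDist (E' := E') J ι x := by
  refine (mem_holoDist_iff hJ).2 ⟨-v, ?_⟩
  rw [mfderiv_inducedF hJ hN hv, hJ.sq_eq_neg, map_neg]

theorem inducedF_mem_holoDist (v : TangentSpace 𝓘(ℝ, E') x) :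
    inducedF hJ hN x v ∈ holoDist (E' := E') J ι x := by
  obtain ⟨d, hd, r, hr, rfl⟩ := hN.exists_add v
  rw [map_add, inducedF_of_mem_realDist hJ hN hr, add_zero]
  exact inducedF_mem_of_mem hJ hN hd

theorem inducedF_inducedF {v : TangentSpace 𝓘(ℝ, E') x} (hv : v ∈ holoDist (E' := E') J ι x) :
    inducedF hJ hN x (inducedF hJ hN x v) = -v := by
  refine injective_mfderiv hN.isImmersion x ?_
  rw [mfderiv_inducedF hJ hN (inducedF_mem_of_mem hJ hN hv), mfderiv_inducedF hJ hN hv,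
    hJ.sq_eq_neg, map_neg]

theorem inducedF_cube (v : TangentSpace 𝓘(ℝ, E') x) :
    inducedF hJ hN x (inducedF hJ hN x (inducedF hJ hN x v)) = -inducedF hJ hN x v :=
  inducedF_inducedF hJ hN (inducedF_mem_holoDist hJ hN v)

theorem mem_realDist_iff_inducedF {v : TangentSpace 𝓘(ℝ, E') x} :
    v ∈ realDist (E' := E') J ι x ↔ inducedF hJ hN x v = 0 := by
  refine ⟨inducedF_of_mem_realDist hJ hN, fun h ↦ ?_⟩
  obtain ⟨d, hd, r, hr, rfl⟩ := hN.exists_add v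
  rw [map_add, inducedF_of_mem_realDist hJ hN hr, add_zero] at h
  have h2 := inducedF_inducedF hJ hN hd
  rw [h, map_zero, zero_eq_neg] at h2
  rwa [h2, zero_add]

/-- Since `J` maps `TN ∩ J(νN)` into `νN`, `F` is the tangential part of `J`. This describes `F`
without the splitting and gives its smoothness. -/
theorem inner_mfderiv_inducedF (v w : TangentSpace 𝓘(ℝ, E') x) :
    inner ℝ (mfderiv 𝓘(ℝ, E') 𝓘(ℝ, E) ι x (inducedF hJ hN x v))
      (mfderiv 𝓘(ℝ, E') 𝓘(ℝ, E) ι x w) =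
    inner ℝ (J (ι x) (mfderiv 𝓘(ℝ, E') 𝓘(ℝ, E) ι x v)) (mfderiv 𝓘(ℝ, E') 𝓘(ℝ, E) ι x w) := by
  obtain ⟨d, hd, r, hr, rfl⟩ := hN.exists_add v
  have h := mem_normalSpace_iff.1 ((mem_realDist_iff hJ).1 hr) w
  rw [real_inner_comm] at h
  rw [map_add, inducedF_of_mem_realDist hJ hN hr, add_zero, mfderiv_inducedF hJ hN hd, map_add,
    map_add, inner_add_left, h, add_zero]

/-- A tangent vector lies in the kernel of `F` when it is orthogonal to `TN ∩ J(TN)`. -/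
theorem inducedF_eq_zero_iff {v : TangentSpace 𝓘(ℝ, E') x} :
    inducedF hJ hN x v = 0 ↔ ∀ w ∈ holoDist (E' := E') J ι x,
      inner ℝ (mfderiv 𝓘(ℝ, E') 𝓘(ℝ, E) ι x v) (mfderiv 𝓘(ℝ, E') 𝓘(ℝ, E) ι x w) = 0 := by
  constructor
  · intro h w hw
    rw [real_inner_comm]
    exact inner_holoDist_realDist hJ hw ((mem_realDist_iff_inducedF hJ hN).2 h)
  · intro h
    refine injective_mfderiv hN.isImmersion x ?_
    -- Here `|Fv|² = γ(Jv, Fv) = -γ(v, F²v)`, and `F²v` lies in `TN ∩ J(TN)`.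
    rw [map_zero, ← inner_self_eq_zero (𝕜 := ℝ), inner_mfderiv_inducedF, hJ.inner_left,
      ← mfderiv_inducedF hJ hN (inducedF_mem_holoDist hJ hN v),
      h _ (inducedF_mem_of_mem hJ hN (inducedF_mem_holoDist hJ hN v)), neg_zero]

end InducedF

/-! ### Smoothness of the induced F structure. -/

section Smoothness

set_option linter.unusedSectionVars false

theorem contMDiffAt_clm_of_apply {E' : Type*} [NormedAddCommGroup E'] [NormedSpace ℝ E']
    {N : Type*} [TopologicalSpace N] [ChartedSpace E' N]
    {V : Type*} [NormedAddCommGroup V] [NormedSpace ℝ V] [FiniteDimensional ℝ V]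
    {G : Type*} [NormedAddCommGroup G] [NormedSpace ℝ G] {T : N → V →L[ℝ] G} {x : N}
    (h : ∀ v, ContMDiffAt 𝓘(ℝ, E') 𝓘(ℝ, G) ∞ (fun z ↦ T z v) x) :
    ContMDiffAt 𝓘(ℝ, E') 𝓘(ℝ, V →L[ℝ] G) ∞ T x := by
  let b := Module.finBasis ℝ V
  have hT : T = fun z ↦ ∑ i, ContinuousLinearMap.smulRightL ℝ V G
      (LinearMap.toContinuousLinearMap (b.coord i)) (T z (b i)) := by
    ext z v
    conv_lhs => rw [← b.sum_repr v, map_sum]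
    simp only [map_smul]
    simp
  rw [hT]
  exact ContMDiffAt.sum fun i _ ↦ (ContinuousLinearMap.contMDiff _).contMDiffAt.comp x (h (b i))

variable {E : Type*} [NormedAddCommGroup E] [NormedSpace ℝ E]
  {M : Type*} [TopologicalSpace M] [ChartedSpace E M] [IsManifold 𝓘(ℝ, E) ∞ M]
  [RiemannianBundle (fun y : M ↦ TangentSpace 𝓘(ℝ, E) y)]
  [IsContMDiffRiemannianBundle 𝓘(ℝ, E) ∞ E (fun y : M ↦ TangentSpace 𝓘(ℝ, E) y)]
  {E' : Type*} [NormedAddCommGroup E'] [NormedSpace ℝ E'] [FiniteDimensional ℝ E']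
  {N : Type*} [TopologicalSpace N] [ChartedSpace E' N] [IsManifold 𝓘(ℝ, E') ∞ N]
  {J : Π y : M, TangentSpace 𝓘(ℝ, E) y →L[ℝ] TangentSpace 𝓘(ℝ, E) y} {ι : N → M} {x : N}

theorem contMDiffAt_mfderiv_apply (hι : ContMDiff 𝓘(ℝ, E') 𝓘(ℝ, E) ∞ ι)
    {X : Π z : N, TangentSpace 𝓘(ℝ, E') z} (hX : CMDiffAt ∞ (T% X) x) :
    ContMDiffAt 𝓘(ℝ, E') (𝓘(ℝ, E).prod 𝓘(ℝ, E)) ∞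
      (fun z ↦ (TotalSpace.mk' E (ι z) (mfderiv 𝓘(ℝ, E') 𝓘(ℝ, E) ι z (X z)) :
        TangentBundle 𝓘(ℝ, E) M)) x := by
  have h := (hι x).mfderiv_const (m := ∞) le_rfl
  exact ContMDiffAt.clm_apply_of_inCoordinates (b₁ := fun z : N ↦ z) (b₂ := ι)
    (ϕ := fun z ↦ mfderiv 𝓘(ℝ, E') 𝓘(ℝ, E) ι z) h hX (hι x)

/-- In a trivialization let `A` be the Gram form of the induced metric and `C` the form `γ(J·, ·)`
on `TN`. Then `F = A⁻¹ C` by `inner_mfderiv_inducedF`, and inversion of operators is smooth. -/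
theorem contMDiff_inducedF (hJ : IsHermitianStructure J) (hN : IsCRSubmanifold (E' := E') J ι) :
    ContMDiff 𝓘(ℝ, E') (𝓘(ℝ, E').prod 𝓘(ℝ, E' →L[ℝ] E')) ∞
      (fun x ↦ (TotalSpace.mk' (E' →L[ℝ] E') x (inducedF hJ hN x) :
        TotalSpace (E' →L[ℝ] E')
          (fun x : N ↦ TangentSpace 𝓘(ℝ, E') x →L[ℝ] TangentSpace 𝓘(ℝ, E') x))) := by
  intro x
  have hι := hN.isImmersion.contMDiff
  rw [contMDiffAt_hom_bundle]
  refine ⟨contMDiffAt_id, ?_⟩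
  let e := trivializationAt E' (TangentSpace 𝓘(ℝ, E')) x
  let B : Π z : N, E' →L[ℝ] TangentSpace 𝓘(ℝ, E) (ι z) := fun z ↦
    mfderiv 𝓘(ℝ, E') 𝓘(ℝ, E) ι z ∘L e.symmL ℝ z
  let A : N → E' →L[ℝ] E' →L[ℝ] ℝ := fun z ↦ (innerSL ℝ).bilinearComp (B z) (B z)
  let C : N → E' →L[ℝ] E' →L[ℝ] ℝ := fun z ↦
    (innerSL ℝ).bilinearComp (J (ι z) ∘L B z) (B z)
  have hmem : ∀ᶠ z in nhds x, z ∈ e.baseSet :=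
    e.open_baseSet.mem_nhds (mem_baseSet_trivializationAt' x)
  have hB : ∀ u : E', ContMDiffAt 𝓘(ℝ, E') (𝓘(ℝ, E).prod 𝓘(ℝ, E)) ∞
      (fun z ↦ (TotalSpace.mk' E (ι z) (B z u) : TangentBundle 𝓘(ℝ, E) M)) x := by
    intro u
    have h := contMDiffAt_mfderiv_apply hι
      (contMDiffAt_extend (k := ∞) 𝓘(ℝ, E') E' (e.symmL ℝ x u))
    have heq : ∀ z ∈ e.baseSet, extend E' (e.symmL ℝ x u) z = e.symmL ℝ z u := fun z hz ↦ by
      have h0 := congrArg Prod.snd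
        (Trivialization.apply_mk_symm e (mem_baseSet_trivializationAt' x) u)
      rw [Trivialization.symmL_apply _ (mem_baseSet_trivializationAt' x),
        Trivialization.symmL_apply _ hz]
      exact congrArg (e.symm z) h0
    refine h.congr_of_eventuallyEq ?_
    filter_upwards [hmem] with z hz
    change TotalSpace.mk' E (ι z) (mfderiv 𝓘(ℝ, E') 𝓘(ℝ, E) ι z (e.symmL ℝ z u)) = _
    rw [heq z hz]
  have hinner : ∀ {V W : Π z : N, TangentSpace 𝓘(ℝ, E) (ι z)},
      ContMDiffAt 𝓘(ℝ, E') (𝓘(ℝ, E).prod 𝓘(ℝ, E)) ∞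
        (fun z ↦ (TotalSpace.mk' E (ι z) (V z) : TangentBundle 𝓘(ℝ, E) M)) x →
      ContMDiffAt 𝓘(ℝ, E') (𝓘(ℝ, E).prod 𝓘(ℝ, E)) ∞
        (fun z ↦ (TotalSpace.mk' E (ι z) (W z) : TangentBundle 𝓘(ℝ, E) M)) x →
      ContMDiffAt 𝓘(ℝ, E') 𝓘(ℝ, ℝ) ∞ (fun z ↦ inner ℝ (V z) (W z)) x := fun hV hW ↦
    ContMDiffAt.inner_bundle (IB := 𝓘(ℝ, E)) (F := E) (b := ι)
      (E := fun y : M ↦ TangentSpace 𝓘(ℝ, E) y) hV hW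
  have hA : ContMDiffAt 𝓘(ℝ, E') 𝓘(ℝ, E' →L[ℝ] E' →L[ℝ] ℝ) ∞ A x :=
    contMDiffAt_clm_of_apply fun u ↦ contMDiffAt_clm_of_apply fun v ↦ hinner (hB u) (hB v)
  have hC : ContMDiffAt 𝓘(ℝ, E') 𝓘(ℝ, E' →L[ℝ] E' →L[ℝ] ℝ) ∞ C x :=
    contMDiffAt_clm_of_apply fun u ↦ contMDiffAt_clm_of_apply fun v ↦
      hinner (ContMDiffAt.clm_bundle_apply (b := ι) ((hJ.contMDiff (ι x)).comp x (hι x)) (hB u))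
        (hB v)
  have hinv : ∀ z ∈ e.baseSet, (A z).IsInvertible := by
    intro z hz
    have hinj : Function.Injective (A z).toLinearMap := by
      refine (injective_iff_map_eq_zero _).2 fun u hu ↦ ?_
      have h1 : inner ℝ (B z u) (B z u) = 0 := congrArg (fun T : E' →L[ℝ] ℝ ↦ T u) hu
      have h2 : mfderiv 𝓘(ℝ, E') 𝓘(ℝ, E) ι z (e.symmL ℝ z u) = 0 := inner_self_eq_zero.1 h1
      have h3 := injective_mfderiv hN.isImmersion z (h2.trans (map_zero _).symm)
      rw [← e.continuousLinearMapAt_symmL (R := ℝ) hz u, h3, map_zero]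
    have hdim : Module.finrank ℝ E' = Module.finrank ℝ (E' →L[ℝ] ℝ) := by
      rw [← (LinearMap.toContinuousLinearMap (𝕜 := ℝ) (E := E') (F' := ℝ)).finrank_eq]
      exact (Subspace.dual_finrank_eq).symm
    exact ⟨(LinearEquiv.ofInjectiveOfFinrankEq (A z).toLinearMap hinj hdim).toContinuousLinearEquiv,
      by ext u v; rfl⟩
  obtain ⟨A₀, hA₀⟩ := hinv x hmem.self_of_nhds
  have hinvA : ContMDiffAt 𝓘(ℝ, E') 𝓘(ℝ, (E' →L[ℝ] ℝ) →L[ℝ] E') ∞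
      (fun z ↦ ContinuousLinearMap.inverse (A z)) x := by
    have h := contDiffAt_map_inverse (n := ∞) A₀
    rw [hA₀] at h
    exact h.contMDiffAt.comp x hA
  refine (hinvA.clm_comp hC).congr_of_eventuallyEq ?_
  filter_upwards [hmem] with z hz
  ext u
  rw [ContinuousLinearMap.inCoordinates_eq hz hz]
  refine ((hinv z hz).inverse_apply_eq.2 ?_).symm
  ext v
  change inner ℝ (J (ι z) (B z u)) (B z v) = inner ℝ (mfderiv 𝓘(ℝ, E') 𝓘(ℝ, E) ι z
    (e.symmL ℝ z (e.continuousLinearEquivAt ℝ z hz (inducedF hJ hN z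
      ((e.continuousLinearEquivAt ℝ z hz).symm u))))) (B z v)
  have h0 : ∀ w, e.symmL ℝ z w = (e.continuousLinearEquivAt ℝ z hz).symm w := fun w ↦
    (congrArg (fun T ↦ T w) (e.symm_continuousLinearEquivAt_eq (R := ℝ) hz)).symm
  rw [h0, ContinuousLinearEquiv.symm_apply_apply, ← h0]
  exact (inner_mfderiv_inducedF hJ hN _ _).symm

end Smoothness
-- The second fundamental form and brackets of `TN ∩ J(TN)` with `TN ∩ J(νN)`.
section Submanifold

set_option linter.unusedSectionVars false

variable {E : Type*} [NormedAddCommGroup E] [NormedSpace ℝ E] [FiniteDimensional ℝ E]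
  {M : Type*} [TopologicalSpace M] [ChartedSpace E M] [IsManifold 𝓘(ℝ, E) ∞ M]
  [RiemannianBundle (fun y : M ↦ TangentSpace 𝓘(ℝ, E) y)]
  [IsContMDiffRiemannianBundle 𝓘(ℝ, E) ∞ E (fun y : M ↦ TangentSpace 𝓘(ℝ, E) y)]
  {E' : Type*} [NormedAddCommGroup E'] [NormedSpace ℝ E'] [FiniteDimensional ℝ E']
  {N : Type*} [TopologicalSpace N] [ChartedSpace E' N] [IsManifold 𝓘(ℝ, E') ∞ N]
  {J : Π y : M, TangentSpace 𝓘(ℝ, E) y →L[ℝ] TangentSpace 𝓘(ℝ, E) y} {ι : N → M} {x : N}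

theorem covAlong_congr {V W : Π z : N, TangentSpace 𝓘(ℝ, E) (ι z)} (h : ∀ᶠ z in nhds x, V z = W z)
    (u : TangentSpace 𝓘(ℝ, E') x) : covAlong ι V x u = covAlong ι W x u := by
  rw [covAlong, covAlong, h.self_of_nhds]
  congr 2
  have h2 : (fun z ↦ coord (ι x) (ι z) (V z)) =ᶠ[nhds x] fun z ↦ coord (ι x) (ι z) (W z) := by
    filter_upwards [h] with z hz
    rw [hz]
  change mvfderiv 𝓘(ℝ, E') (fun z ↦ coord (ι x) (ι z) (V z)) x u = _
  rw [mvfderiv_congr h2]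
  rfl

/-- The fields extend to `M` near `ι x`, where this is metric compatibility of `∇`; `covAlong_J`
rests on the same reduction. -/
theorem covAlong_metric (hι : Manifold.IsImmersion 𝓘(ℝ, E') 𝓘(ℝ, E) ∞ ι)
    {V W : Π z : N, TangentSpace 𝓘(ℝ, E) (ι z)} (hV : MDiffAlong (E' := E') ι V x)
    (hW : MDiffAlong (E' := E') ι W x) (u : TangentSpace 𝓘(ℝ, E') x) :
    mvfderiv 𝓘(ℝ, E') (fun z ↦ inner ℝ (V z) (W z)) x u =
      inner ℝ (covAlong ι V x u) (W x) + inner ℝ (V x) (covAlong ι W x u) := by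
  obtain ⟨V', hV', hVe⟩ := hV.exists_extension hι
  obtain ⟨W', hW', hWe⟩ := hW.exists_extension hι
  rw [covAlong_eq_leviCivita hι.contMDiff hV' hVe, covAlong_eq_leviCivita hι.contMDiff hW' hWe,
    ← hVe.self_of_nhds, ← hWe.self_of_nhds, ← leviCivita_metric hV' hW',
    ← mvfderiv_comp_mfderiv (mdiffAt_inner hV' hW') ((hι.contMDiff x).mdifferentiableAt (by simp))]
  rw [mvfderiv_congr (f := fun z ↦ inner ℝ (V z) (W z))
    (g := fun z ↦ inner ℝ (V' (ι z)) (W' (ι z)))]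
  filter_upwards [hVe, hWe] with z h1 h2
  rw [h1, h2]

theorem covAlong_J (hJ : IsHermitianStructure J)
    (hι : Manifold.IsImmersion 𝓘(ℝ, E') 𝓘(ℝ, E) ∞ ι)
    {V : Π z : N, TangentSpace 𝓘(ℝ, E) (ι z)} (hV : MDiffAlong (E' := E') ι V x)
    (u : TangentSpace 𝓘(ℝ, E') x) :
    covAlong ι (fun z ↦ J (ι z) (V z)) x u =
      nablaJ J (ι x) (mfderiv 𝓘(ℝ, E') 𝓘(ℝ, E) ι x u) (V x) + J (ι x) (covAlong ι V x u) := by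
  obtain ⟨V', hV', hVe⟩ := hV.exists_extension hι
  rw [covAlong_eq_leviCivita hι.contMDiff hV' hVe,
    covAlong_eq_leviCivita hι.contMDiff (hJ.mdiffAt hV') (hVe.mono fun z hz ↦ by rw [hz]),
    leviCivita_J hJ hV', hVe.self_of_nhds]

/-- The second fundamental form against a normal vector can be computed with any extension. -/
theorem inner_secondFundamentalForm (hι : ContMDiff 𝓘(ℝ, E') 𝓘(ℝ, E) ∞ ι)
    {Y : Π z : N, TangentSpace 𝓘(ℝ, E') z} (hY : MDiffAt (T% Y) x)
    (u : TangentSpace 𝓘(ℝ, E') x) {n : TangentSpace 𝓘(ℝ, E) (ι x)}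
    (hn : n ∈ normalSpace E E' ι x) :
    inner ℝ (secondFundamentalForm ι x u (Y x)) n =
      inner ℝ (covAlong ι (fun z ↦ mfderiv 𝓘(ℝ, E') 𝓘(ℝ, E) ι z (Y z)) x u) n := by
  have : CompleteSpace E' := FiniteDimensional.complete ℝ E'
  have : FiniteDimensional ℝ (TangentSpace 𝓘(ℝ, E) (ι x)) :=
    inferInstanceAs (FiniteDimensional ℝ E)
  have hu := mdifferentiableAt_extend 𝓘(ℝ, E') E' u
  -- Exchanging the two fields costs only a tangential bracket, which `n` does not see. After the
  -- exchange `Y` enters only through `Y x`.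
  have h1 := covAlong_mfderiv_sub hι hu hY
  have h2 := covAlong_mfderiv_sub hι hu (mdifferentiableAt_extend 𝓘(ℝ, E') E' (Y x))
  simp only [extend_apply_self] at h1 h2
  have h3 : inner ℝ (secondFundamentalForm ι x u (Y x)) n = inner ℝ (covAlong ι (fun z ↦
      mfderiv 𝓘(ℝ, E') 𝓘(ℝ, E) ι z (extend E' (Y x) z)) x u) n := by
    rw [secondFundamentalForm, Submodule.inner_starProjection_left_eq_right,
      Submodule.starProjection_eq_self_iff.2 hn]
  rw [h3, sub_eq_iff_eq_add.1 h1, sub_eq_iff_eq_add.1 h2, inner_add_left, inner_add_left,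
    mem_normalSpace_iff.1 hn, mem_normalSpace_iff.1 hn]

theorem inner_secondFundamentalForm_comm (hι : ContMDiff 𝓘(ℝ, E') 𝓘(ℝ, E) ∞ ι)
    (u v : TangentSpace 𝓘(ℝ, E') x) {n : TangentSpace 𝓘(ℝ, E) (ι x)}
    (hn : n ∈ normalSpace E E' ι x) :
    inner ℝ (secondFundamentalForm ι x u v) n = inner ℝ (secondFundamentalForm ι x v u) n := by
  have : CompleteSpace E' := FiniteDimensional.complete ℝ E'
  have hu := mdifferentiableAt_extend 𝓘(ℝ, E') E' u
  have hv := mdifferentiableAt_extend 𝓘(ℝ, E') E' v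
  have h1 := inner_secondFundamentalForm hι hv u hn
  have h2 := inner_secondFundamentalForm hι hu v hn
  have h3 := covAlong_mfderiv_sub hι hu hv
  simp only [extend_apply_self] at h1 h2 h3
  rw [h1, h2, sub_eq_iff_eq_add.1 h3, inner_add_left, mem_normalSpace_iff.1 hn, zero_add]

variable (hJ : IsHermitianStructure J) (hN : IsCRSubmanifold (E' := E') J ι)

theorem contMDiffOn_inducedF_apply {X : Π z : N, TangentSpace 𝓘(ℝ, E') z} {U : Set N}
    (hX : ContMDiffOn 𝓘(ℝ, E') (𝓘(ℝ, E').prod 𝓘(ℝ, E')) ∞ (T% X) U) :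
    ContMDiffOn 𝓘(ℝ, E') (𝓘(ℝ, E').prod 𝓘(ℝ, E')) ∞ (T% (fun z ↦ inducedF hJ hN z (X z))) U :=
  ContMDiffOn.clm_bundle_apply (b := fun z : N ↦ z) (contMDiff_inducedF hJ hN).contMDiffOn hX

include hJ hN in
-- `F` takes values in `TN ∩ J(TN)`, and `F(-Fv) = v` there, so `F` is applied to an extension of
-- `-Fv`.
theorem exists_holoDist_section {v : TangentSpace 𝓘(ℝ, E') x}
    (hv : v ∈ holoDist (E' := E') J ι x) :
    ∃ X : Π z : N, TangentSpace 𝓘(ℝ, E') z, X x = v ∧ (∀ z, X z ∈ holoDist (E' := E') J ι z) ∧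
      ∃ U : Set N, IsOpen U ∧ x ∈ U ∧
        ContMDiffOn 𝓘(ℝ, E') (𝓘(ℝ, E').prod 𝓘(ℝ, E')) ∞ (T% X) U := by
  obtain ⟨U, hU, h⟩ := exists_contMDiffOn_extend 𝓘(ℝ, E') E' (k := ∞)
    (-inducedF hJ hN x v)
  obtain ⟨O, hOU, hO, hxO⟩ := mem_nhds_iff.1 hU
  refine ⟨fun z ↦ inducedF hJ hN z (extend E' (-inducedF hJ hN x v) z), ?_,
    fun z ↦ inducedF_mem_holoDist hJ hN _, O, hO, hxO,
    contMDiffOn_inducedF_apply hJ hN (h.mono hOU)⟩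
  change inducedF hJ hN x (extend E' (-inducedF hJ hN x v) x) = v
  rw [extend_apply_self, map_neg, inducedF_inducedF hJ hN hv, neg_neg]

include hJ hN in
-- `1 + F²` projects onto `ker F`, because `F³ = -F`, and fixes `v`.
theorem exists_realDist_section {v : TangentSpace 𝓘(ℝ, E') x}
    (hv : v ∈ realDist (E' := E') J ι x) :
    ∃ X : Π z : N, TangentSpace 𝓘(ℝ, E') z, X x = v ∧ (∀ z, X z ∈ realDist (E' := E') J ι z) ∧
      MDiffAt (T% X) x := by
  obtain ⟨U, hU, h⟩ := exists_contMDiffOn_extend 𝓘(ℝ, E') E' (k := ∞) v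
  have hF := contMDiffOn_inducedF_apply hJ hN (contMDiffOn_inducedF_apply hJ hN h)
  refine ⟨extend E' v + fun z ↦ inducedF hJ hN z (inducedF hJ hN z (extend E' v z)), ?_,
    fun z ↦ ?_, mdifferentiableAt_add_section (mdifferentiableAt_extend ..)
      ((hF.contMDiffAt hU).mdifferentiableAt (by simp))⟩
  · rw [Pi.add_apply, extend_apply_self, inducedF_of_mem_realDist hJ hN hv, map_zero, add_zero]
  · rw [mem_realDist_iff_inducedF hJ hN, Pi.add_apply, map_add, inducedF_cube, add_neg_cancel]

variable {X X' Y Y' Z : Π z : N, TangentSpace 𝓘(ℝ, E') z}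

/-- The invariance of `TN ∩ J(TN)` along `TN ∩ J(νN)` in terms of the geometry of the immersion. -/
theorem inner_bracket_sub (hX : MDiffAt (T% X) x) (hX' : MDiffAt (T% X') x)
    (hY : MDiffAt (T% Y) x) (hZ : MDiffAt (T% Z) x)
    (hXD : ∀ᶠ z in nhds x, X z ∈ holoDist (E' := E') J ι z)
    (hXX' : ∀ᶠ z in nhds x, X' z = inducedF hJ hN z (X z))
    (hYD : ∀ᶠ z in nhds x, Y z ∈ holoDist (E' := E') J ι z)
    (hZR : ∀ᶠ z in nhds x, Z z ∈ realDist (E' := E') J ι z) :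
    inner ℝ (mfderiv 𝓘(ℝ, E') 𝓘(ℝ, E) ι x (mlieBracket 𝓘(ℝ, E') X' Z x
        - inducedF hJ hN x (mlieBracket 𝓘(ℝ, E') X Z x)))
      (mfderiv 𝓘(ℝ, E') 𝓘(ℝ, E) ι x (Y x)) =
    -inner ℝ (secondFundamentalForm ι x (inducedF hJ hN x (X x)) (inducedF hJ hN x (Y x))
        - secondFundamentalForm ι x (X x) (Y x))
      (J (ι x) (mfderiv 𝓘(ℝ, E') 𝓘(ℝ, E) ι x (Z x))) -
    inner ℝ (nablaJ J (ι x) (mfderiv 𝓘(ℝ, E') 𝓘(ℝ, E) ι x (Z x))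
        (mfderiv 𝓘(ℝ, E') 𝓘(ℝ, E) ι x (X x)))
      (mfderiv 𝓘(ℝ, E') 𝓘(ℝ, E) ι x (Y x)) := by
  have : CompleteSpace E' := FiniteDimensional.complete ℝ E'
  have hι := hN.isImmersion.contMDiff
  let d : ∀ W : Π z : N, TangentSpace 𝓘(ℝ, E') z, Π z : N, TangentSpace 𝓘(ℝ, E) (ι z) :=
    fun W z ↦ mfderiv 𝓘(ℝ, E') 𝓘(ℝ, E) ι z (W z)
  have hd : ∀ {W : Π z : N, TangentSpace 𝓘(ℝ, E') z}, MDiffAt (T% W) x →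
      MDiffAlong (E' := E') ι (d W) x := fun hW ↦ mdiffAlong_mfderiv hι hW
  have hY' : MDiffAt (T% (fun z ↦ inducedF hJ hN z (Y z))) x :=
    MDifferentiableAt.clm_bundle_apply (b := fun z : N ↦ z)
      ((contMDiff_inducedF hJ hN x).mdifferentiableAt (by simp)) hY
  have hdX' : ∀ᶠ z in nhds x, d X' z = J (ι z) (d X z) := by
    filter_upwards [hXD, hXX'] with z h1 h2
    exact (congrArg _ h2).trans (mfderiv_inducedF hJ hN h1)
  have hdY' : ∀ᶠ z in nhds x, d (fun z ↦ inducedF hJ hN z (Y z)) z = J (ι z) (d Y z) := by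
    filter_upwards [hYD] with z h1
    exact mfderiv_inducedF hJ hN h1
  have hn := (mem_realDist_iff hJ).1 hZR.self_of_nhds
  -- the metric identities
  have hzero : ∀ {W : Π z : N, TangentSpace 𝓘(ℝ, E') z} (_ : MDiffAt (T% W) x)
      (_ : ∀ᶠ z in nhds x, W z ∈ holoDist (E' := E') J ι z) (u : TangentSpace 𝓘(ℝ, E') x),
      inner ℝ (covAlong ι (d Z) x u) (d W x) = -inner ℝ (covAlong ι (d W) x u) (d Z x) := by
    intro W hW hWD u
    have h := covAlong_metric hN.isImmersion (hd hZ) (hd hW) u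
    have h0 : (fun z ↦ inner ℝ (d Z z) (d W z)) =ᶠ[nhds x] fun _ ↦ (0 : ℝ) := by
      filter_upwards [hWD, hZR] with z h1 h2
      rw [real_inner_comm]
      exact inner_holoDist_realDist hJ h1 h2
    rw [mvfderiv_congr h0, mvfderiv_const, zero_apply, real_inner_comm _ (d Z x)] at h
    linarith
  have e1 := hzero hY hYD (X' x)
  have e2 := hzero hY' (hYD.mono fun z hz ↦ inducedF_mem_of_mem hJ hN hz) (X x)
  rw [hdY'.self_of_nhds, covAlong_congr hdY', covAlong_J hJ hN.isImmersion (hd hY)] at e2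
  -- the second fundamental forms
  have b1 := inner_secondFundamentalForm hι hY' (X' x) hn
  have b2 := inner_secondFundamentalForm hι hY (X x) hn
  change _ = inner ℝ (covAlong ι (d _) x (X' x)) _ at b1
  change _ = inner ℝ (covAlong ι (d Y) x (X x)) _ at b2
  rw [covAlong_congr hdY', covAlong_J hJ hN.isImmersion (hd hY)] at b1
  -- the brackets
  have t1 := covAlong_mfderiv_sub hι hX' hZ
  have t2 := covAlong_mfderiv_sub hι hX hZ
  change covAlong ι (d Z) x (X' x) - covAlong ι (d X') x (Z x) = _ at t1
  change covAlong ι (d Z) x (X x) - covAlong ι (d X) x (Z x) = _ at t2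
  -- As `X' = FX` is carried to `J(dι X)`, the term `J ∇_Z X` will cancel the one from `F[X, Z]`,
  -- leaving only `(∇_Z J)X`.
  rw [covAlong_congr hdX', covAlong_J hJ hN.isImmersion (hd hX)] at t1
  have c : mfderiv 𝓘(ℝ, E') 𝓘(ℝ, E) ι x (X' x) = J (ι x) (d X x) := hdX'.self_of_nhds
  -- With `∇_{Jv} J = J ∇_v J`, the `∇J` term of `b1` becomes `γ((∇_X J)Y, Z)`, the quantity that
  -- also occurs in `e2`; it is eliminated between the two.
  rw [c, nablaJ_J_left hJ, inner_add_left, hJ.inner_map_map, hJ.inner_map_map] at b1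
  rw [inner_add_left, hJ.inner_left] at e2
  rw [← hXX'.self_of_nhds, map_sub, inner_sub_left, inner_mfderiv_inducedF, ← t1, ← t2, map_sub,
    inner_sub_left, inner_sub_left, inner_add_left, inner_sub_left, b1, b2,
    hJ.inner_left (covAlong ι (d Z) x (X x))]
  simp only [d] at e1 e2 ⊢
  linarith

/-- The two conditions on `dΩ` and `b` say that `[FX, Z] - F[X, Z]` is in the kernel of `F`. -/
theorem forall_extDerivTwo_and_secondFundamentalForm_iff :
    (∀ X ∈ holoDist (E' := E') J ι x, ∀ Y ∈ holoDist (E' := E') J ι x,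
        ∀ Z ∈ realDist (E' := E') J ι x,
      extDerivTwo (kahlerForm J) (ι x)
          (mfderiv 𝓘(ℝ, E') 𝓘(ℝ, E) ι x X) (mfderiv 𝓘(ℝ, E') 𝓘(ℝ, E) ι x Y)
          (mfderiv 𝓘(ℝ, E') 𝓘(ℝ, E) ι x Z) =
        extDerivTwo (kahlerForm J) (ι x)
          (J (ι x) (mfderiv 𝓘(ℝ, E') 𝓘(ℝ, E) ι x X))
          (J (ι x) (mfderiv 𝓘(ℝ, E') 𝓘(ℝ, E) ι x Y))
          (mfderiv 𝓘(ℝ, E') 𝓘(ℝ, E) ι x Z) ∧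
      inner ℝ (secondFundamentalForm ι x (inducedF hJ hN x X) (inducedF hJ hN x Y)
          - secondFundamentalForm ι x X Y)
        (J (ι x) (mfderiv 𝓘(ℝ, E') 𝓘(ℝ, E) ι x Z)) = 0) ↔
    ∀ X X' Z : Π z : N, TangentSpace 𝓘(ℝ, E') z,
      (∃ U : Set N, IsOpen U ∧ x ∈ U ∧
        ContMDiffOn 𝓘(ℝ, E') (𝓘(ℝ, E').prod 𝓘(ℝ, E')) ∞ (T% X) U) →
      MDiffAt (T% Z) x →
      (∀ᶠ z in nhds x, X z ∈ holoDist (E' := E') J ι z) →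
      (∀ᶠ z in nhds x, X' z = inducedF hJ hN z (X z)) →
      (∀ᶠ z in nhds x, Z z ∈ realDist (E' := E') J ι z) →
      inducedF hJ hN x (mlieBracket 𝓘(ℝ, E') X' Z x) =
        inducedF hJ hN x (inducedF hJ hN x (mlieBracket 𝓘(ℝ, E') X Z x)) := by
  have hF : ∀ {X X' : Π z : N, TangentSpace 𝓘(ℝ, E') z}, MDiffAt (T% X) x →
      (∀ᶠ z in nhds x, X' z = inducedF hJ hN z (X z)) → MDiffAt (T% X') x := by
    intro X X' hX h
    refine (MDifferentiableAt.clm_bundle_apply (b := fun z : N ↦ z)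
      ((contMDiff_inducedF hJ hN x).mdifferentiableAt (by simp)) hX).congr_of_eventuallyEq ?_
    filter_upwards [h] with z hz
    rw [hz]
  have hsm : ∀ {X : Π z : N, TangentSpace 𝓘(ℝ, E') z}, (∃ U : Set N, IsOpen U ∧ x ∈ U ∧
      ContMDiffOn 𝓘(ℝ, E') (𝓘(ℝ, E').prod 𝓘(ℝ, E')) ∞ (T% X) U) → MDiffAt (T% X) x :=
    fun ⟨U, hU, hxU, h⟩ ↦ (h.contMDiffAt (hU.mem_nhds hxU)).mdifferentiableAt (by simp)
  constructor
  · intro H X X' Z hX hZ hXD hXX' hZR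
    rw [← sub_eq_zero, ← map_sub, inducedF_eq_zero_iff]
    intro w hw
    obtain ⟨Y, rfl, hYD, hY⟩ := exists_holoDist_section hJ hN hw
    obtain ⟨h1, h2⟩ := H _ hXD.self_of_nhds _ hw _ hZR.self_of_nhds
    have h3 := extDerivTwo_kahlerForm_sub hJ (mfderiv 𝓘(ℝ, E') 𝓘(ℝ, E) ι x (X x))
      (mfderiv 𝓘(ℝ, E') 𝓘(ℝ, E) ι x (Y x)) (mfderiv 𝓘(ℝ, E') 𝓘(ℝ, E) ι x (Z x))
    rw [inner_bracket_sub hJ hN (hsm hX) (hF (hsm hX) hXX') (hsm hY) hZ hXD hXX' (.of_forall hYD)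
      hZR, h2]
    linarith
  · intro H v hv w hw r hr
    have key : ∀ v ∈ holoDist (E' := E') J ι x, ∀ w ∈ holoDist (E' := E') J ι x,
        -inner ℝ (secondFundamentalForm ι x (inducedF hJ hN x v) (inducedF hJ hN x w)
          - secondFundamentalForm ι x v w) (J (ι x) (mfderiv 𝓘(ℝ, E') 𝓘(ℝ, E) ι x r)) -
        inner ℝ (nablaJ J (ι x) (mfderiv 𝓘(ℝ, E') 𝓘(ℝ, E) ι x r)
            (mfderiv 𝓘(ℝ, E') 𝓘(ℝ, E) ι x v))
          (mfderiv 𝓘(ℝ, E') 𝓘(ℝ, E) ι x w) = 0 := by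
      intro v hv w hw
      obtain ⟨X, rfl, hXD, hX⟩ := exists_holoDist_section hJ hN hv
      obtain ⟨Y, rfl, hYD, hY⟩ := exists_holoDist_section hJ hN hw
      obtain ⟨Z, rfl, hZR, hZ⟩ := exists_realDist_section hJ hN hr
      have h := H X (fun z ↦ inducedF hJ hN z (X z)) Z hX hZ (.of_forall hXD)
        (.of_forall fun _ ↦ rfl) (.of_forall hZR)
      rw [← sub_eq_zero, ← map_sub, inducedF_eq_zero_iff] at h
      rw [← h _ hw, inner_bracket_sub hJ hN (hsm hX) (hF (hsm hX) (.of_forall fun _ ↦ rfl))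
        (hsm hY) hZ (.of_forall hXD) (.of_forall fun _ ↦ rfl) (.of_forall hYD) (.of_forall hZR)]
    have hn := (mem_realDist_iff hJ).1 hr
    have hι := hN.isImmersion.contMDiff
    -- Exchanging `v` and `w` keeps the `b` term and changes the sign of the `∇J` term, so each
    -- vanishes separately.
    have k1 := key v hv w hw
    have k2 := key w hw v hv
    rw [inner_sub_left, inner_secondFundamentalForm_comm hι _ _ hn,
      inner_secondFundamentalForm_comm hι w v hn, ← inner_sub_left, inner_nablaJ hJ,
      real_inner_comm (nablaJ _ _ _ _)] at k2
    have h3 := extDerivTwo_kahlerForm_sub hJ (mfderiv 𝓘(ℝ, E') 𝓘(ℝ, E) ι x v)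
      (mfderiv 𝓘(ℝ, E') 𝓘(ℝ, E) ι x w) (mfderiv 𝓘(ℝ, E') 𝓘(ℝ, E) ι x r)
    constructor <;> linarith

end Submanifold
-- Complex 1-forms and their Lie derivatives.
section Forms

set_option linter.unusedSectionVars false

variable {E' : Type*} [NormedAddCommGroup E'] [NormedSpace ℝ E'] [FiniteDimensional ℝ E']
  {N : Type*} [TopologicalSpace N] [ChartedSpace E' N] [IsManifold 𝓘(ℝ, E') ∞ N] {x : N}

/-- A complex 1-form is smooth if its values on the coordinate vector fields are. -/
theorem contMDiffAt_form {β : Π z : N, TangentSpace 𝓘(ℝ, E') z →L[ℝ] ℂ}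
    (h : ∀ v : TangentSpace 𝓘(ℝ, E') x,
      ContMDiffAt 𝓘(ℝ, E') 𝓘(ℝ, ℂ) ∞ (fun z ↦ β z (extend E' v z)) x) :
    ContMDiffAt 𝓘(ℝ, E') (𝓘(ℝ, E').prod 𝓘(ℝ, E' →L[ℝ] ℂ)) ∞
      (fun z ↦ (TotalSpace.mk' (E' →L[ℝ] ℂ) z (β z) : TotalSpace (E' →L[ℝ] ℂ)
        (fun z : N ↦ TangentSpace 𝓘(ℝ, E') z →L[ℝ] Bundle.Trivial N ℂ z))) x := by
  rw [contMDiffAt_hom_bundle]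
  refine ⟨contMDiffAt_id, contMDiffAt_clm_of_apply fun u ↦ ?_⟩
  let e := trivializationAt E' (TangentSpace 𝓘(ℝ, E')) x
  refine (h (e.symmL ℝ x u)).congr_of_eventuallyEq ?_
  filter_upwards [e.open_baseSet.mem_nhds (mem_baseSet_trivializationAt' x)] with z hz
  have h0 := congrArg Prod.snd
    (Trivialization.apply_mk_symm e (mem_baseSet_trivializationAt' x) u)
  have heq : extend E' (e.symmL ℝ x u) z = e.symmL ℝ z u := by
    rw [Trivialization.symmL_apply _ (mem_baseSet_trivializationAt' x),
      Trivialization.symmL_apply _ hz]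
    exact congrArg (e.symm z) h0
  rw [heq]
  simp [ContinuousLinearMap.inCoordinates, e]

/-- The values of a smooth complex 1-form on a smooth vector field. -/
theorem contMDiffAt_form_apply {β : Π z : N, TangentSpace 𝓘(ℝ, E') z →L[ℝ] ℂ}
    (h : ContMDiffAt 𝓘(ℝ, E') (𝓘(ℝ, E').prod 𝓘(ℝ, E' →L[ℝ] ℂ)) ∞
      (fun z ↦ (TotalSpace.mk' (E' →L[ℝ] ℂ) z (β z) : TotalSpace (E' →L[ℝ] ℂ)
        (fun z : N ↦ TangentSpace 𝓘(ℝ, E') z →L[ℝ] Bundle.Trivial N ℂ z))) x)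
    {W : Π z : N, TangentSpace 𝓘(ℝ, E') z} (hW : CMDiffAt ∞ (T% W) x) :
    ContMDiffAt 𝓘(ℝ, E') 𝓘(ℝ, ℂ) ∞ (fun z ↦ β z (W z)) x := by
  have h2 := ContMDiffAt.clm_bundle_apply (b := fun z : N ↦ z)
    (E₂ := Bundle.Trivial N ℂ) h hW
  rw [contMDiffAt_totalSpace] at h2
  exact h2.2

theorem mdiffAt_form_apply {β : Π z : N, TangentSpace 𝓘(ℝ, E') z →L[ℝ] ℂ}
    (h : ContMDiffAt 𝓘(ℝ, E') (𝓘(ℝ, E').prod 𝓘(ℝ, E' →L[ℝ] ℂ)) ∞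
      (fun z ↦ (TotalSpace.mk' (E' →L[ℝ] ℂ) z (β z) : TotalSpace (E' →L[ℝ] ℂ)
        (fun z : N ↦ TangentSpace 𝓘(ℝ, E') z →L[ℝ] Bundle.Trivial N ℂ z))) x)
    {W : Π z : N, TangentSpace 𝓘(ℝ, E') z} (hW : MDiffAt (T% W) x) :
    MDifferentiableAt 𝓘(ℝ, E') 𝓘(ℝ, ℂ) (fun z ↦ β z (W z)) x := by
  have h2 := MDifferentiableAt.clm_bundle_apply (b := fun z : N ↦ z)
    (E₂ := Bundle.Trivial N ℂ) (h.mdifferentiableAt (by simp)) hW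
  rw [mdifferentiableAt_totalSpace] at h2
  exact h2.2

/-- The expression `Z(β(W)) - β([Z, W])`, where `β` is the 1-form of `T` and `Z` the complex vector
field of `S`. -/
noncomputable def GenField.lieAlong (S T : GenField E' N) (W : Π z : N, TangentSpace 𝓘(ℝ, E') z)
    (x : N) : ℂ :=
  S.derivFun (fun z ↦ T.form z (W z)) x - (T.form x (mlieBracket 𝓘(ℝ, E') S.re W x)
    + Complex.I * T.form x (mlieBracket 𝓘(ℝ, E') S.im W x))

/-- `Z(β(W)) - β([Z, W])` is tensorial in `W`. -/
theorem GenField.exists_clm_lieAlong {S T : GenField E' N}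
    (hT : ContMDiffAt 𝓘(ℝ, E') (𝓘(ℝ, E').prod 𝓘(ℝ, E' →L[ℝ] ℂ)) ∞
      (fun z ↦ (TotalSpace.mk' (E' →L[ℝ] ℂ) z (T.form z) : TotalSpace (E' →L[ℝ] ℂ)
        (fun z : N ↦ TangentSpace 𝓘(ℝ, E') z →L[ℝ] Bundle.Trivial N ℂ z))) x) :
    ∃ L : TangentSpace 𝓘(ℝ, E') x →L[ℝ] ℂ,
      ∀ W : Π z : N, TangentSpace 𝓘(ℝ, E') z, MDiffAt (T% W) x → S.lieAlong T W x = L (W x) := by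
  have : CompleteSpace E' := FiniteDimensional.complete ℝ E'
  -- Tensoriality allows the Lie derivative, defined through `extend`, to be evaluated on sections
  -- adapted to the splitting of `TN`.
  have ht : TensorialAt 𝓘(ℝ, E') E' (fun W : Π z : N, TangentSpace 𝓘(ℝ, E') z ↦
      S.lieAlong T W x) x := by
    refine ⟨fun {f W} hf hW ↦ ?_, fun {W W'} hW hW' ↦ ?_⟩
    · have h1 : (fun z ↦ T.form z ((f • W) z)) = f • (fun z ↦ T.form z (W z) : N → ℂ) := by
        ext z; simp
      simp only [GenField.lieAlong, GenField.derivFun]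
      rw [h1, mvfderiv_smul hf (mdiffAt_form_apply hT hW), mlieBracket_smul_right hf hW,
        mlieBracket_smul_right hf hW]
      simp only [add_apply, smul_apply, ContinuousLinearMap.smulRight_apply, map_add, map_smul,
        Complex.real_smul]
      ring
    · have h1 : (fun z ↦ T.form z ((W + W') z)) =
          (fun z ↦ T.form z (W z) : N → ℂ) + fun z ↦ T.form z (W' z) := by
        ext z; simp
      simp only [GenField.lieAlong, GenField.derivFun]
      rw [h1, mvfderiv_add (mdiffAt_form_apply hT hW) (mdiffAt_form_apply hT hW'),
        mlieBracket_add_right hW hW', mlieBracket_add_right hW hW']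
      simp only [add_apply, map_add]
      ring
  exact ⟨TensorialAt.mkHom (fun W ↦ S.lieAlong T W x) x ht,
    fun W hW ↦ (TensorialAt.mkHom_apply ht hW).symm⟩

end Forms

/-! ### Integrability of `F` on `TN ∩ J(TN)`. -/

section Nijenhuis

set_option linter.unusedSectionVars false

variable {E : Type*} [NormedAddCommGroup E] [NormedSpace ℝ E] [FiniteDimensional ℝ E]
  {M : Type*} [TopologicalSpace M] [ChartedSpace E M] [IsManifold 𝓘(ℝ, E) ∞ M]
  [RiemannianBundle (fun y : M ↦ TangentSpace 𝓘(ℝ, E) y)]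
  [IsContMDiffRiemannianBundle 𝓘(ℝ, E) ∞ E (fun y : M ↦ TangentSpace 𝓘(ℝ, E) y)]
  {E' : Type*} [NormedAddCommGroup E'] [NormedSpace ℝ E'] [FiniteDimensional ℝ E']
  {N : Type*} [TopologicalSpace N] [ChartedSpace E' N] [IsManifold 𝓘(ℝ, E') ∞ N]
  {J : Π y : M, TangentSpace 𝓘(ℝ, E) y →L[ℝ] TangentSpace 𝓘(ℝ, E) y} {ι : N → M} {x : N}
  (hJ : IsHermitianStructure J) (hN : IsCRSubmanifold (E' := E') J ι)
  {X X' Y Y' : Π z : N, TangentSpace 𝓘(ℝ, E') z}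

/-- The complex structure `F` of `TN ∩ J(TN)` is integrable. -/
theorem inducedF_bracket (hX : MDiffAt (T% X) x) (hX' : MDiffAt (T% X') x)
    (hY : MDiffAt (T% Y) x) (hY' : MDiffAt (T% Y') x)
    (hXD : ∀ᶠ z in nhds x, X z ∈ holoDist (E' := E') J ι z)
    (hXX' : ∀ᶠ z in nhds x, X' z = inducedF hJ hN z (X z))
    (hYD : ∀ᶠ z in nhds x, Y z ∈ holoDist (E' := E') J ι z)
    (hYY' : ∀ᶠ z in nhds x, Y' z = inducedF hJ hN z (Y z)) :
    mlieBracket 𝓘(ℝ, E') X Y x - mlieBracket 𝓘(ℝ, E') X' Y' x ∈ holoDist (E' := E') J ι x ∧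
    inducedF hJ hN x (mlieBracket 𝓘(ℝ, E') X Y x - mlieBracket 𝓘(ℝ, E') X' Y' x) =
      mlieBracket 𝓘(ℝ, E') X' Y x + mlieBracket 𝓘(ℝ, E') X Y' x := by
  have : CompleteSpace E' := FiniteDimensional.complete ℝ E'
  have hι := hN.isImmersion.contMDiff
  let d : ∀ W : Π z : N, TangentSpace 𝓘(ℝ, E') z, Π z : N, TangentSpace 𝓘(ℝ, E) (ι z) :=
    fun W z ↦ mfderiv 𝓘(ℝ, E') 𝓘(ℝ, E) ι z (W z)
  have hd : ∀ {W W' : Π z : N, TangentSpace 𝓘(ℝ, E') z} (_ : MDiffAt (T% W) x)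
      (_ : ∀ᶠ z in nhds x, W z ∈ holoDist (E' := E') J ι z)
      (_ : ∀ᶠ z in nhds x, W' z = inducedF hJ hN z (W z)),
      d W' x = J (ι x) (d W x) ∧ ∀ u, covAlong ι (d W') x u =
        nablaJ J (ι x) (mfderiv 𝓘(ℝ, E') 𝓘(ℝ, E) ι x u) (d W x) +
          J (ι x) (covAlong ι (d W) x u) := by
    intro W W' hW h1 h2
    have h : ∀ᶠ z in nhds x, d W' z = J (ι z) (d W z) := by
      filter_upwards [h1, h2] with z h1 h2
      exact (congrArg _ h2).trans (mfderiv_inducedF hJ hN h1)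
    exact ⟨h.self_of_nhds, fun u ↦ by
      rw [covAlong_congr h, covAlong_J hJ hN.isImmersion (mdiffAlong_mfderiv hι hW)]⟩
  obtain ⟨dX, cX⟩ := hd hX hXD hXX'
  obtain ⟨dY, cY⟩ := hd hY hYD hYY'
  -- All brackets are expanded by the torsion-free connection along `ι`, and the `∇J` terms cancel
  -- by `nablaJ_J_left`. Since the left side is tangent, this gives both the membership in `TN ∩
  -- J(TN)` and the value of `F`.
  have key : mfderiv 𝓘(ℝ, E') 𝓘(ℝ, E) ι x
        (mlieBracket 𝓘(ℝ, E') X' Y x + mlieBracket 𝓘(ℝ, E') X Y' x) =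
      J (ι x) (mfderiv 𝓘(ℝ, E') 𝓘(ℝ, E) ι x
        (mlieBracket 𝓘(ℝ, E') X Y x - mlieBracket 𝓘(ℝ, E') X' Y' x)) := by
    rw [map_add, map_sub, ← covAlong_mfderiv_sub hι hX' hY, ← covAlong_mfderiv_sub hι hX hY',
      ← covAlong_mfderiv_sub hι hX hY, ← covAlong_mfderiv_sub hι hX' hY']
    change covAlong ι (d Y) x (X' x) - covAlong ι (d X') x (Y x) +
      (covAlong ι (d Y') x (X x) - covAlong ι (d X) x (Y' x)) =
      J (ι x) (covAlong ι (d Y) x (X x) - covAlong ι (d X) x (Y x) -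
      (covAlong ι (d Y') x (X' x) - covAlong ι (d X') x (Y' x)))
    simp only [cX, cY]
    change covAlong ι (d Y) x (X' x) - (nablaJ J (ι x) (d Y x) (d X x) + _) +
      (nablaJ J (ι x) (d X x) (d Y x) + _ - covAlong ι (d X) x (Y' x)) =
      J (ι x) (covAlong ι (d Y) x (X x) - covAlong ι (d X) x (Y x) -
      (nablaJ J (ι x) (d X' x) (d Y x) + _ - (nablaJ J (ι x) (d Y' x) (d X x) + _)))
    rw [dX, dY]
    simp only [map_sub, map_add, nablaJ_J_left hJ, hJ.sq_eq_neg]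
    abel
  have hD := (mem_holoDist_iff hJ).2 ⟨_, key⟩
  refine ⟨hD, injective_mfderiv hN.isImmersion x ?_⟩
  rw [mfderiv_inducedF hJ hN hD, key]

end Nijenhuis
-- Closure under Courant brackets: sufficiency.
section Courant

set_option linter.unusedSectionVars false

variable {E : Type*} [NormedAddCommGroup E] [NormedSpace ℝ E] [FiniteDimensional ℝ E]
  {M : Type*} [TopologicalSpace M] [ChartedSpace E M] [IsManifold 𝓘(ℝ, E) ∞ M]
  [RiemannianBundle (fun y : M ↦ TangentSpace 𝓘(ℝ, E) y)]
  [IsContMDiffRiemannianBundle 𝓘(ℝ, E) ∞ E (fun y : M ↦ TangentSpace 𝓘(ℝ, E) y)]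
  {E' : Type*} [NormedAddCommGroup E'] [NormedSpace ℝ E'] [FiniteDimensional ℝ E']
  {N : Type*} [TopologicalSpace N] [ChartedSpace E' N] [IsManifold 𝓘(ℝ, E') ∞ N]
  {J : Π y : M, TangentSpace 𝓘(ℝ, E) y →L[ℝ] TangentSpace 𝓘(ℝ, E) y} {ι : N → M} {x : N}
  (hJ : IsHermitianStructure J) (hN : IsCRSubmanifold (E' := E') J ι)

theorem mvfderiv_const_mul {f : N → ℂ} (c : ℂ)
    (hf : MDifferentiableAt 𝓘(ℝ, E') 𝓘(ℝ, ℂ) f x) (v : TangentSpace 𝓘(ℝ, E') x) :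
    mvfderiv 𝓘(ℝ, E') (fun z ↦ c * f z) x v = c * mvfderiv 𝓘(ℝ, E') f x v :=
  mvfderiv_clm_comp (ContinuousLinearMap.mul ℝ ℂ c) hf v

/-- A 1-form in the dual `i`-eigenbundle vanishes on the kernel of `F`. -/
theorem form_eq_zero {θ : TangentSpace 𝓘(ℝ, E') x → ℂ} {v : TangentSpace 𝓘(ℝ, E') x}
    (hθ : ∀ w, -θ (inducedF hJ hN x w) = Complex.I * θ w) (h0 : θ 0 = 0)
    (hv : inducedF hJ hN x v = 0) : θ v = 0 := by
  have h := hθ v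
  rw [hv, h0, neg_zero] at h
  exact (mul_eq_zero.1 h.symm).resolve_left Complex.I_ne_zero

/-- On an eigenform, multiplication by `i` is precomposition with `-F`; its value on a complex
vector is thus its value on a real one. -/
theorem form_add_I_mul {θ : TangentSpace 𝓘(ℝ, E') x →L[ℝ] ℂ}
    (hθ : ∀ w, -θ (inducedF hJ hN x w) = Complex.I * θ w) (v w : TangentSpace 𝓘(ℝ, E') x) :
    θ v + Complex.I * θ w = θ (v - inducedF hJ hN x w) := by
  rw [← hθ, map_sub, sub_eq_add_neg]

/-- The Lie derivative of a 1-form of the dual eigenbundle along a vector field of the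
eigenbundle. -/
theorem lieDeriv_isEigen {S T : GenField E' N}
    (hre : MDiffAt (T% S.re) x) (him : MDiffAt (T% S.im) x)
    (hT : ContMDiffAt 𝓘(ℝ, E') (𝓘(ℝ, E').prod 𝓘(ℝ, E' →L[ℝ] ℂ)) ∞
      (fun z ↦ (TotalSpace.mk' (E' →L[ℝ] ℂ) z (T.form z) : TotalSpace (E' →L[ℝ] ℂ)
        (fun z : N ↦ TangentSpace 𝓘(ℝ, E') z →L[ℝ] Bundle.Trivial N ℂ z))) x)
    (hD : ∀ᶠ z in nhds x, S.im z ∈ holoDist (E' := E') J ι z)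
    (hF : ∀ᶠ z in nhds x, S.re z = inducedF hJ hN z (S.im z))
    (hβ : ∀ᶠ z in nhds x, ∀ w, -T.form z (inducedF hJ hN z w) = Complex.I * T.form z w)
    (H : ∀ Z : Π z : N, TangentSpace 𝓘(ℝ, E') z, MDiffAt (T% Z) x →
      (∀ᶠ z in nhds x, Z z ∈ realDist (E' := E') J ι z) →
      inducedF hJ hN x (mlieBracket 𝓘(ℝ, E') S.re Z x) =
        inducedF hJ hN x (inducedF hJ hN x (mlieBracket 𝓘(ℝ, E') S.im Z x)))
    (w : TangentSpace 𝓘(ℝ, E') x) :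
    -S.lieDeriv T x (inducedF hJ hN x w) = Complex.I * S.lieDeriv T x w := by
  obtain ⟨L, hL⟩ := GenField.exists_clm_lieAlong (S := S) hT
  have hLd : ∀ w, S.lieDeriv T x w = L w := fun w ↦ by
    have h := hL (extend E' w) (mdifferentiableAt_extend ..)
    rwa [extend_apply_self] at h
  have hβx := hβ.self_of_nhds
  obtain ⟨d, hd, r, hr, rfl⟩ := hN.exists_add w
  -- Along `TN ∩ J(νN)` the function `β(Z)` vanishes identically, so only `-β([S.re, Z] - F[S.im,
  -- Z])` remains, and `H` puts that vector in `ker F`.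
  have hLr : L r = 0 := by
    obtain ⟨Z, rfl, hZR, hZ⟩ := exists_realDist_section hJ hN hr
    have h0 : (fun z ↦ T.form z (Z z)) =ᶠ[nhds x] fun _ ↦ (0 : ℂ) := by
      filter_upwards [hβ] with z hz
      exact form_eq_zero hJ hN hz (map_zero _) (inducedF_of_mem_realDist hJ hN (hZR z))
    have hker : inducedF hJ hN x (mlieBracket 𝓘(ℝ, E') S.re Z x -
        inducedF hJ hN x (mlieBracket 𝓘(ℝ, E') S.im Z x)) = 0 := by
      rw [map_sub, H Z hZ (.of_forall hZR), sub_self]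
    rw [← hL Z hZ, GenField.lieAlong, GenField.derivFun, mvfderiv_congr h0, mvfderiv_const,
      form_add_I_mul hJ hN hβx, form_eq_zero hJ hN hβx (map_zero _) hker]
    simp
  have hLd2 : L (inducedF hJ hN x d) = -(Complex.I * L d) := by
    obtain ⟨W, rfl, hWD, U, hU, hxU, hWs⟩ := exists_holoDist_section hJ hN hd
    have hW : MDiffAt (T% W) x :=
      (hWs.contMDiffAt (hU.mem_nhds hxU)).mdifferentiableAt (by simp)
    have hFW : MDiffAt (T% (fun z ↦ inducedF hJ hN z (W z))) x :=
      ((contMDiffOn_inducedF_apply hJ hN hWs).contMDiffAt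
        (hU.mem_nhds hxU)).mdifferentiableAt (by simp)
    have h0 : (fun z ↦ T.form z (inducedF hJ hN z (W z))) =ᶠ[nhds x]
        fun z ↦ -Complex.I * T.form z (W z) := by
      filter_upwards [hβ] with z hz
      rw [neg_mul, ← hz, neg_neg]
    obtain ⟨hGD, hG⟩ := inducedF_bracket hJ hN him hre hW hFW hD hF (.of_forall hWD)
      (.of_forall fun _ ↦ rfl)
    have hG2 := inducedF_inducedF hJ hN hGD
    rw [hG, map_add] at hG2
    -- By integrability the two arguments differ by `(1 + F²)[S.im, W]`, which lies in `ker F` and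
    -- is killed by `β`.
    have hker : T.form x (mlieBracket 𝓘(ℝ, E') S.re (fun z ↦ inducedF hJ hN z (W z)) x
          - inducedF hJ hN x (mlieBracket 𝓘(ℝ, E') S.im (fun z ↦ inducedF hJ hN z (W z)) x)) =
        T.form x (inducedF hJ hN x (mlieBracket 𝓘(ℝ, E') S.re W x
          - inducedF hJ hN x (mlieBracket 𝓘(ℝ, E') S.im W x))) := by
      rw [← sub_eq_zero, ← map_sub]
      have h1 : mlieBracket 𝓘(ℝ, E') S.re (fun z ↦ inducedF hJ hN z (W z)) x
          - inducedF hJ hN x (mlieBracket 𝓘(ℝ, E') S.im (fun z ↦ inducedF hJ hN z (W z)) x)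
          - inducedF hJ hN x (mlieBracket 𝓘(ℝ, E') S.re W x
            - inducedF hJ hN x (mlieBracket 𝓘(ℝ, E') S.im W x)) =
          mlieBracket 𝓘(ℝ, E') S.im W x +
            inducedF hJ hN x (inducedF hJ hN x (mlieBracket 𝓘(ℝ, E') S.im W x)) := by
        rw [map_sub, eq_sub_of_add_eq' hG2]
        abel
      rw [h1]
      refine form_eq_zero hJ hN hβx (map_zero _) ?_
      rw [map_add, inducedF_cube, add_neg_cancel]
    rw [← hL _ hFW, ← hL _ hW]
    simp only [GenField.lieAlong, GenField.derivFun]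
    rw [mvfderiv_congr h0, mvfderiv_const_mul _ (mdiffAt_form_apply hT hW),
      mvfderiv_const_mul _ (mdiffAt_form_apply hT hW), form_add_I_mul hJ hN hβx,
      form_add_I_mul hJ hN hβx, hker, ← neg_eq_iff_eq_neg.2 (hβx _).symm]
    ring
  rw [hLd, hLd, map_add, map_add, map_add, hLr, hLd2, inducedF_of_mem_realDist hJ hN hr, map_zero]
  ring

/-- The value is `β(A - FB)` for `A + iB` the vector part of `S`, and `A = FB`. The exact term of
the Courant bracket therefore vanishes on eigensections. -/
theorem pair_eq_zero {S T : GenField E' N} {y : N}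
    (hS : IsEigen (inducedF hJ hN y) (S.re y) (S.im y) (S.form y))
    (hT : IsEigen (inducedF hJ hN y) (T.re y) (T.im y) (T.form y)) : S.pair T y = 0 := by
  rw [GenField.pair, form_add_I_mul hJ hN hT.2.2, hS.2.1, sub_self, map_zero]

theorem isClassicalCRF_inducedF
    (H : ∀ x : N, ∀ X X' Z : Π z : N, TangentSpace 𝓘(ℝ, E') z,
      (∃ U : Set N, IsOpen U ∧ x ∈ U ∧
        ContMDiffOn 𝓘(ℝ, E') (𝓘(ℝ, E').prod 𝓘(ℝ, E')) ∞ (T% X) U) →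
      MDiffAt (T% Z) x →
      (∀ᶠ z in nhds x, X z ∈ holoDist (E' := E') J ι z) →
      (∀ᶠ z in nhds x, X' z = inducedF hJ hN z (X z)) →
      (∀ᶠ z in nhds x, Z z ∈ realDist (E' := E') J ι z) →
      inducedF hJ hN x (mlieBracket 𝓘(ℝ, E') X' Z x) =
        inducedF hJ hN x (inducedF hJ hN x (mlieBracket 𝓘(ℝ, E') X Z x))) :
    IsClassicalCRF (inducedF hJ hN) := by
  refine ⟨contMDiff_inducedF hJ hN, fun x v ↦ by rw [inducedF_cube, neg_add_cancel], ?_⟩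
  intro U hU S T hS hT hSe hTe x hx
  have hUx := hU.mem_nhds hx
  have him : ∀ {S : GenField E' N},
      (∀ x ∈ U, IsEigen (inducedF hJ hN x) (S.re x) (S.im x) (S.form x)) →
      ∀ᶠ z in nhds x, S.im z ∈ holoDist (E' := E') J ι z := fun {S} hSe ↦ by
    filter_upwards [hUx] with z hz
    rw [← neg_neg (S.im z), ← (hSe z hz).1]
    exact neg_mem (inducedF_mem_holoDist hJ hN _)
  have hre : ∀ {S : GenField E' N},
      (∀ x ∈ U, IsEigen (inducedF hJ hN x) (S.re x) (S.im x) (S.form x)) →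
      ∀ᶠ z in nhds x, S.re z = inducedF hJ hN z (S.im z) := fun hSe ↦ by
    filter_upwards [hUx] with z hz
    exact (hSe z hz).2.1.symm
  have hd : ∀ {X : Π z : N, TangentSpace 𝓘(ℝ, E') z},
      ContMDiffOn 𝓘(ℝ, E') (𝓘(ℝ, E').prod 𝓘(ℝ, E')) ∞ (T% X) U → MDiffAt (T% X) x :=
    fun h ↦ (h.contMDiffAt hUx).mdifferentiableAt (by simp)
  have hlie : ∀ {S T : GenField E' N}, S.IsSmoothOn U → T.IsSmoothOn U →
      (∀ x ∈ U, IsEigen (inducedF hJ hN x) (S.re x) (S.im x) (S.form x)) →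
      (∀ x ∈ U, IsEigen (inducedF hJ hN x) (T.re x) (T.im x) (T.form x)) →
      ∀ w, -S.lieDeriv T x (inducedF hJ hN x w) = Complex.I * S.lieDeriv T x w := by
    intro S T hS hT hSe hTe
    refine lieDeriv_isEigen hJ hN (hd hS.re) (hd hS.im) (hT.form.contMDiffAt hUx) (him hSe)
      (hre hSe) ?_ fun Z hZ hZR ↦
        H x S.im S.re Z ⟨U, hU, hx, hS.im⟩ hZ (him hSe) (hre hSe) hZR
    filter_upwards [hUx] with z hz
    exact (hTe z hz).2.2
  -- Taking the imaginary parts as `X, Y` makes the real parts `FX, FY`; the difference of brackets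
  -- supplied here is minus `bracketRe`.
  obtain ⟨hGD, hG⟩ := inducedF_bracket hJ hN (hd hS.im) (hd hS.re) (hd hT.im) (hd hT.re)
    (him hSe) (hre hSe) (him hTe) (hre hTe)
  have hG2 := inducedF_inducedF hJ hN hGD
  rw [hG] at hG2
  have e1 : S.bracketRe T x = -(mlieBracket 𝓘(ℝ, E') S.im T.im x
      - mlieBracket 𝓘(ℝ, E') S.re T.re x) := (neg_sub _ _).symm
  have e2 : S.bracketIm T x = mlieBracket 𝓘(ℝ, E') S.re T.im x +
      mlieBracket 𝓘(ℝ, E') S.im T.re x := rfl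
  refine ⟨by rw [e1, e2, map_neg, hG], by rw [e1, e2, hG2], fun w ↦ ?_⟩
  have hp : (fun z ↦ T.pair S z - S.pair T z) =ᶠ[nhds x] fun _ ↦ (0 : ℂ) := by
    filter_upwards [hUx] with z hz
    rw [pair_eq_zero hJ hN (hSe z hz) (hTe z hz), pair_eq_zero hJ hN (hTe z hz) (hSe z hz),
      sub_self]
  have h1 := hlie hS hT hSe hTe w
  have h2 := hlie hT hS hTe hSe w
  simp only [GenField.bracketForm]
  rw [mvfderiv_congr hp, mvfderiv_const]
  simp only [zero_apply, mul_zero, add_zero]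
  linear_combination h1 - h2

end Courant
-- Test sections: necessity.
section Converse

set_option linter.unusedSectionVars false

variable {E : Type*} [NormedAddCommGroup E] [NormedSpace ℝ E] [FiniteDimensional ℝ E]
  {M : Type*} [TopologicalSpace M] [ChartedSpace E M] [IsManifold 𝓘(ℝ, E) ∞ M]
  [RiemannianBundle (fun y : M ↦ TangentSpace 𝓘(ℝ, E) y)]
  [IsContMDiffRiemannianBundle 𝓘(ℝ, E) ∞ E (fun y : M ↦ TangentSpace 𝓘(ℝ, E) y)]
  {E' : Type*} [NormedAddCommGroup E'] [NormedSpace ℝ E'] [FiniteDimensional ℝ E']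
  {N : Type*} [TopologicalSpace N] [ChartedSpace E' N] [IsManifold 𝓘(ℝ, E') ∞ N]
  {J : Π y : M, TangentSpace 𝓘(ℝ, E) y →L[ℝ] TangentSpace 𝓘(ℝ, E) y} {ι : N → M} {x : N}
  (hJ : IsHermitianStructure J) (hN : IsCRSubmanifold (E' := E') J ι)

/-- Local smooth sections of the dual `i`-eigenbundle. -/
theorem exists_form (α₀ : TangentSpace 𝓘(ℝ, E') x →L[ℝ] ℂ) :
    ∃ β : Π z : N, TangentSpace 𝓘(ℝ, E') z →L[ℝ] ℂ,
      (∀ v, β x v = α₀ (inducedF hJ hN x v) +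
        Complex.I * α₀ (inducedF hJ hN x (inducedF hJ hN x v))) ∧
      (∀ z v, -β z (inducedF hJ hN z v) = Complex.I * β z v) ∧
      ∃ U : Set N, IsOpen U ∧ x ∈ U ∧
        ContMDiffOn 𝓘(ℝ, E') (𝓘(ℝ, E').prod 𝓘(ℝ, E' →L[ℝ] ℂ)) ∞
          (fun z ↦ (TotalSpace.mk' (E' →L[ℝ] ℂ) z (β z) : TotalSpace (E' →L[ℝ] ℂ)
            (fun z : N ↦ TangentSpace 𝓘(ℝ, E') z →L[ℝ] Bundle.Trivial N ℂ z))) U := by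
  let α : Π z : N, TangentSpace 𝓘(ℝ, E') z →L[ℝ] ℂ :=
    extend (E' →L[ℝ] ℂ) (E := fun z : N ↦ TangentSpace 𝓘(ℝ, E') z →L[ℝ] Bundle.Trivial N ℂ z) α₀
  have hα : α x = α₀ := extend_apply_self (E' →L[ℝ] ℂ)
    (E := fun z : N ↦ TangentSpace 𝓘(ℝ, E') z →L[ℝ] Bundle.Trivial N ℂ z) α₀
  obtain ⟨O, hO, h⟩ := exists_contMDiffOn_extend 𝓘(ℝ, E') (E' →L[ℝ] ℂ) (k := ∞)
    (V := fun z : N ↦ TangentSpace 𝓘(ℝ, E') z →L[ℝ] Bundle.Trivial N ℂ z) α₀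
  obtain ⟨U, hUO, hU, hxU⟩ := mem_nhds_iff.1 hO
  -- For any `α`, the form `β = α ∘ F + i α ∘ F²` satisfies `-β ∘ F = iβ`, because `F³ = -F`.
  refine ⟨fun z ↦ α z ∘L inducedF hJ hN z +
    Complex.I • (α z ∘L inducedF hJ hN z ∘L inducedF hJ hN z), fun v ↦ ?_, fun z v ↦ ?_,
    U, hU, hxU, fun y hy ↦ ContMDiffAt.contMDiffWithinAt (contMDiffAt_form fun v ↦ ?_)⟩
  · simp [hα]
  · simp only [add_apply, ContinuousLinearMap.comp_apply, smul_apply, inducedF_cube, map_neg,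
      smul_eq_mul]
    linear_combination (-α z (inducedF hJ hN z (inducedF hJ hN z v))) * Complex.I_mul_I
  · have hs : ∀ {X : Π z : N, TangentSpace 𝓘(ℝ, E') z}, CMDiffAt ∞ (T% X) y →
        CMDiffAt ∞ (T% (fun z ↦ inducedF hJ hN z (X z))) y := fun hX ↦
      ContMDiffAt.clm_bundle_apply (b := fun z : N ↦ z) (contMDiff_inducedF hJ hN y) hX
    have hα' := (h.mono hUO).contMDiffAt (hU.mem_nhds hy)
    have h1 := hs (contMDiffAt_extend (k := ∞) 𝓘(ℝ, E') E' v)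
    exact (contMDiffAt_form_apply (β := α) hα' h1).add
      ((ContinuousLinearMap.mul ℝ ℂ Complex.I).contMDiff.contMDiffAt.comp y
        (contMDiffAt_form_apply (β := α) hα' (hs h1)))

/-- Closure is tested on `(FX + iX, 0)` and `(0, β)`. The field `X` is part of a test section and
has to be smooth; `Z` enters only as the argument of a tensorial expression, so differentiability is
enough. -/
theorem IsClassicalCRF.inducedF_bracket (H : IsClassicalCRF (inducedF hJ hN))
    {X X' Z : Π z : N, TangentSpace 𝓘(ℝ, E') z}
    (hX : ∃ U : Set N, IsOpen U ∧ x ∈ U ∧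
      ContMDiffOn 𝓘(ℝ, E') (𝓘(ℝ, E').prod 𝓘(ℝ, E')) ∞ (T% X) U)
    (hZ : MDiffAt (T% Z) x)
    (hXD : ∀ᶠ z in nhds x, X z ∈ holoDist (E' := E') J ι z)
    (hXX' : ∀ᶠ z in nhds x, X' z = inducedF hJ hN z (X z))
    (hZR : ∀ᶠ z in nhds x, Z z ∈ realDist (E' := E') J ι z) :
    inducedF hJ hN x (mlieBracket 𝓘(ℝ, E') X' Z x) =
      inducedF hJ hN x (inducedF hJ hN x (mlieBracket 𝓘(ℝ, E') X Z x)) := by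
  have hbr : mlieBracket 𝓘(ℝ, E') X' Z x =
      mlieBracket 𝓘(ℝ, E') (fun z ↦ inducedF hJ hN z (X z)) Z x :=
    Filter.EventuallyEq.mlieBracket_vectorField_eq hXX' .rfl
  rw [hbr, ← sub_eq_zero, ← map_sub]
  set v := mlieBracket 𝓘(ℝ, E') (fun z ↦ inducedF hJ hN z (X z)) Z x -
    inducedF hJ hN x (mlieBracket 𝓘(ℝ, E') X Z x) with hv
  obtain ⟨U₁, hU₁, hx₁, hXs⟩ := hX
  obtain ⟨U₂, hU₂D, hU₂, hx₂⟩ := eventually_nhds_iff.1 hXD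
  have key : ∀ α : TangentSpace 𝓘(ℝ, E') x →L[ℝ] ℂ, α (inducedF hJ hN x v) +
      Complex.I * α (inducedF hJ hN x (inducedF hJ hN x v)) = 0 := by
    intro α
    obtain ⟨β, hβx, hβ, U₃, hU₃, hx₃, hβs⟩ := exists_form hJ hN α
    rw [← hβx]
    have hO : IsOpen (U₁ ∩ U₂ ∩ U₃) := (hU₁.inter hU₂).inter hU₃
    have hxO : x ∈ U₁ ∩ U₂ ∩ U₃ := ⟨⟨hx₁, hx₂⟩, hx₃⟩
    have hXO := hXs.mono fun z (hz : z ∈ U₁ ∩ U₂ ∩ U₃) ↦ hz.1.1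
    let S : GenField E' N := ⟨fun z ↦ inducedF hJ hN z (X z), X, fun _ ↦ 0⟩
    let T : GenField E' N := ⟨fun _ ↦ 0, fun _ ↦ 0, β⟩
    have hzero : ContMDiffOn 𝓘(ℝ, E') (𝓘(ℝ, E').prod 𝓘(ℝ, E')) ∞
        (fun z : N ↦ (TotalSpace.mk' E' z 0 : TangentBundle 𝓘(ℝ, E') N)) (U₁ ∩ U₂ ∩ U₃) :=
      (contMDiff_zeroSection ℝ (TangentSpace 𝓘(ℝ, E') : N → Type _)).contMDiffOn
    have hS : S.IsSmoothOn (U₁ ∩ U₂ ∩ U₃) := ⟨contMDiffOn_inducedF_apply hJ hN hXO, hXO,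
      (contMDiff_zeroSection ℝ (fun z : N ↦ TangentSpace 𝓘(ℝ, E') z →L[ℝ]
        Bundle.Trivial N ℂ z)).contMDiffOn⟩
    have hT : T.IsSmoothOn (U₁ ∩ U₂ ∩ U₃) := ⟨hzero, hzero, hβs.mono fun z hz ↦ hz.2⟩
    have hTx := hT.form.contMDiffAt (hO.mem_nhds hxO)
    have hSe : ∀ z ∈ U₁ ∩ U₂ ∩ U₃, IsEigen (inducedF hJ hN z) (S.re z) (S.im z) (S.form z) :=
      fun z hz ↦ ⟨inducedF_inducedF hJ hN (hU₂D z hz.1.2), rfl, by simp [S]⟩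
    have hTe : ∀ z ∈ U₁ ∩ U₂ ∩ U₃, IsEigen (inducedF hJ hN z) (T.re z) (T.im z) (T.form z) :=
      fun z hz ↦ ⟨by simp [T], by simp [T], hβ z⟩
    have hθ := (H.closed _ hO S T hS hT hSe hTe x hxO).2.2
    obtain ⟨L, hL⟩ := GenField.exists_clm_lieAlong (S := S) hTx
    have hform : ∀ w, S.bracketForm T x w = L w := by
      intro w
      have hp : (fun z ↦ T.pair S z - S.pair T z) =ᶠ[nhds x] fun _ ↦ (0 : ℂ) := by
        filter_upwards [hO.mem_nhds hxO] with z hz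
        rw [pair_eq_zero hJ hN (hSe z hz) (hTe z hz), pair_eq_zero hJ hN (hTe z hz) (hSe z hz),
          sub_self]
      have hTS : T.lieDeriv S x w = 0 := by
        simp [GenField.lieDeriv, GenField.derivFun, S, T]
      have h := hL (extend E' w) (mdifferentiableAt_extend ..)
      rw [extend_apply_self] at h
      rw [GenField.bracketForm, mvfderiv_congr hp, mvfderiv_const, hTS, ← h]
      simp only [zero_apply, mul_zero, add_zero, sub_zero]
      rfl
    -- The form part of the bracket is an eigenform, hence vanishes on `ker F`; expanding its value
    -- on `Z` leaves `-β(v)`.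
    have hLZ : L (Z x) = 0 := form_eq_zero hJ hN (fun w ↦ by rw [← hform, ← hform, hθ])
      (map_zero L) (inducedF_of_mem_realDist hJ hN hZR.self_of_nhds)
    have h0 : (fun z ↦ T.form z (Z z)) =ᶠ[nhds x] fun _ ↦ (0 : ℂ) := by
      filter_upwards [hZR] with z hz
      exact form_eq_zero hJ hN (hβ z) (map_zero _) (inducedF_of_mem_realDist hJ hN hz)
    rw [← hL Z hZ, GenField.lieAlong, GenField.derivFun, mvfderiv_congr h0, mvfderiv_const,
      form_add_I_mul hJ hN (hβ x)] at hLZ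
    change _ - β x v = 0 at hLZ
    simpa using hLZ
  by_contra hne
  -- For a real functional `a`, the real part of `key` is `a(Fv)`, and real functionals separate
  -- vectors.
  obtain ⟨a, ha⟩ := SeparatingDual.exists_ne_zero (R := ℝ) (V := E') hne
  let A : TangentSpace 𝓘(ℝ, E') x →L[ℝ] ℝ := a
  have h : ((A (inducedF hJ hN x v) : ℂ) +
      Complex.I * (A (inducedF hJ hN x (inducedF hJ hN x v)) : ℂ)).re = 0 :=
    congrArg Complex.re (key (Complex.ofRealCLM ∘L A))
  have h2 : A (inducedF hJ hN x v) = 0 := by simpa using h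
  exact ha h2

end Converse
end CRSub

theorem theorem3p1
    {E : Type*} [NormedAddCommGroup E] [NormedSpace ℝ E] [FiniteDimensional ℝ E]
    {M : Type*} [TopologicalSpace M] [ChartedSpace E M] [IsManifold 𝓘(ℝ, E) ∞ M]
    [RiemannianBundle (fun y : M ↦ TangentSpace 𝓘(ℝ, E) y)]
    [IsContMDiffRiemannianBundle 𝓘(ℝ, E) ∞ E (fun y : M ↦ TangentSpace 𝓘(ℝ, E) y)]
    {E' : Type*} [NormedAddCommGroup E'] [NormedSpace ℝ E'] [FiniteDimensional ℝ E']
    {N : Type*} [TopologicalSpace N] [ChartedSpace E' N] [IsManifold 𝓘(ℝ, E') ∞ N]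
    (J : Π y : M, TangentSpace 𝓘(ℝ, E) y →L[ℝ] TangentSpace 𝓘(ℝ, E) y)
    (hJ : CRSub.IsHermitianStructure J)
    (ι : N → M) (hN : CRSub.IsCRSubmanifold (E' := E') J ι) :
    CRSub.IsClassicalCRF (CRSub.inducedF hJ hN) ↔
      ∀ x : N, ∀ X ∈ CRSub.holoDist (E' := E') J ι x, ∀ Y ∈ CRSub.holoDist (E' := E') J ι x,
        ∀ Z ∈ CRSub.realDist (E' := E') J ι x,
          CRSub.extDerivTwo (CRSub.kahlerForm J) (ι x)
              (mfderiv 𝓘(ℝ, E') 𝓘(ℝ, E) ι x X) (mfderiv 𝓘(ℝ, E') 𝓘(ℝ, E) ι x Y)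
              (mfderiv 𝓘(ℝ, E') 𝓘(ℝ, E) ι x Z) =
            CRSub.extDerivTwo (CRSub.kahlerForm J) (ι x)
              (J (ι x) (mfderiv 𝓘(ℝ, E') 𝓘(ℝ, E) ι x X))
              (J (ι x) (mfderiv 𝓘(ℝ, E') 𝓘(ℝ, E) ι x Y))
              (mfderiv 𝓘(ℝ, E') 𝓘(ℝ, E) ι x Z) ∧
          inner ℝ
            (CRSub.secondFundamentalForm ι x (CRSub.inducedF hJ hN x X) (CRSub.inducedF hJ hN x Y)
              - CRSub.secondFundamentalForm ι x X Y)
            (J (ι x) (mfderiv 𝓘(ℝ, E') 𝓘(ℝ, E) ι x Z)) = 0 := by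
  rw [forall_congr' fun x ↦
    CRSub.forall_extDerivTwo_and_secondFundamentalForm_iff (x := x) hJ hN]
  exact ⟨fun H x X X' Z hX hZ hXD hXX' hZR ↦ H.inducedF_bracket hJ hN hX hZ hXD hXX' hZR,
    CRSub.isClassicalCRF_inducedF hJ hN⟩
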